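/- Let $\Omega\subset\mathbb{R}^d$, $d\ge 1$, be a bounded open set (no regularity of $\partial\Omega$ is needed) and let $T>0$. Let $\|\cdot\|_\Omega$ and $(\cdot,\cdot)_\Omega$ be the norm and inner product of $L^2(\Omega)$ and of $L^2(\Omega;\mathbb{R}^d)$. Let $H^1_0(\Omega)$ be the closure of $C_0^\infty(\Omega)$ in $H^1(\Omega)$, and let $H^{-1}(\Omega)$ be its dual, with pairing $\langle\cdot,\cdot\rangle$ and norm $\|\Phi\|_{H^{-1}(\Omega)}=\sup_{v\in H^1_0(\Omega)\setminus\{0\}}\langle\Phi,v\rangle/\|\nabla v\|_\Omega$; embed $L^2(\Omega)$ in $H^{-1}(\Omega)$ by $\langle w,v\rangle=(w,v)_\Omega$. Let $$X=L^2(0,T;H^1_0(\Omega)),\qquad \|v\|_X^2=\int_0^T\|\nabla v\|_\Omega^2\,dt,$$ $$Y=L^2(0,T;H^1_0(\Omega))\cap H^1(0,T;H^{-1}(\Omega))\subset C([0,T];L^2(\Omega)),\qquad Y_T=\{\varphi\in Y:\ \varphi(T)=0\},$$ $$\|\varphi\|_{Y_T}^2=\int_0^T\big(\|\partial_t\varphi\|_{H^{-1}(\Omega)}^2+\|\nabla\varphi\|_\Omega^2\big)\,dt+\|\varphi(0)\|_\Omega^2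 .$$ Let $f\in L^2(0,T;H^{-1}(\Omega))$ and $u_0\in H^1_0(\Omega)$, and let $u\in Y$ be the weak solution of the heat equation, that is, $u(0)=u_0$ and, for almost every $t\in(0,T)$, $$\langle\partial_t u(t),v\rangle+(\nabla u(t),\nabla v)_\Omega=\langle f(t),v\rangle\qquad\text{for all } v\in H^1_0(\Omega).$$ Let $0=t_0<t_1<\dots<t_N=T$, $\tau_n=t_n-t_{n-1}$, let $f_n=\frac1{\tau_n}\int_{t_{n-1}}^{t_n}f(t)\,dt\in H^{-1}(\Omega)$, and let $f_\tau$ be the piecewise constant function that equals $f_n$ on $(t_{n-1},t_n)$. Let $u_1,\dots,u_N\in H^1_0(\Omega)$ be the implicit Euler approximations started from $u_0$, given for $n=1,\dots,N$ by $$\Big(\frac{u_n-u_{n-1}}{\tau_n},v\Big)_\Omega+(\nabla u_n,\nabla v)_\Omega=\langle f_n,v\rangle\qquad\text{for all } v\in H^1_0(\Omega).$$ Let $u_\tau$ be the left-continuous piecewise constant function on $[0,T]$ that equals $u_n$ on $(t_{n-1},t_n]$ and $u_0$ at $t=0$, and let $U_\tau$ be the continuous function on $[0,T]$ that is affine on each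 $[t_{n-1},t_n]$ and satisfies $U_\tau(t_n)=u_n$ for $n=0,\dots,N$. Let $$\eta_J=\|u_\tau-U_\tau\|_X,\qquad \eta_{\mathrm{osc},\tau,X}=\sup_{\varphi\in Y_T\setminus\{0\}}\frac{\int_0^T\langle f-f_\tau,\varphi\rangle\,dt}{\|\varphi\|_{Y_T}}$$ (the supremum of the empty set being $0$). Then $\eta_{\mathrm{osc},\tau,X}$ is finite, and $$\|u-u_\tau\|_X\le\eta_J+\eta_{\mathrm{osc},\tau,X},\qquad \|u-U_\tau\|_X\le\eta_J+\eta_{\mathrm{osc},\tau,X}.$$ -/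

import Mathlib

open MeasureTheory Set
open scoped ContDiff

noncomputable section

namespace ParabolicHeat

/-! ### Lebesgue and Sobolev spaces on an open set of Euclidean space -/

/-- The Euclidean space of dimension `d`. -/
abbrev Euc (d : ℕ) : Type := EuclideanSpace ℝ (Fin d)

/-- `L²(Ω)`. -/
abbrev L2 {d : ℕ} (Ω : Set (Euc d)) : Type := Lp ℝ 2 (volume.restrict Ω)

/-- `L²(Ω; ℝᵈ)`. -/
abbrev L2Vec {d : ℕ} (Ω : Set (Euc d)) : Type := Lp (Euc d) 2 (volume.restrict Ω)

/-- Pairs `(v, g)` in `L²(Ω) × L²(Ω; ℝᵈ)`, with the norm `(‖v‖² + ‖g‖²)^(1/2)`. A function `v` in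
`H¹(Ω)` is represented by the pair `(v, ∇v)`, whose norm is the usual `H¹`-norm of `v`. -/
abbrev Pairs {d : ℕ} (Ω : Set (Euc d)) : Type := WithLp 2 (L2 Ω × L2Vec Ω)

/-- `C₀^∞(Ω)`: smooth real functions with compact support contained in `Ω`. -/
def IsTest {d : ℕ} (Ω : Set (Euc d)) (ψ : Euc d → ℝ) : Prop :=
  ContDiff ℝ ∞ ψ ∧ HasCompactSupport ψ ∧ tsupport ψ ⊆ Ω

/-- `g` is the weak gradient of `v` on `Ω`. -/
def IsWeakGradient {d : ℕ} (Ω : Set (Euc d)) (v : L2 Ω) (g : L2Vec Ω) : Prop :=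
  ∀ ψ : Euc d → ℝ, IsTest Ω ψ → ∀ e : Euc d,
    ∫ x in Ω, v x * fderiv ℝ ψ x e = - ∫ x in Ω, inner ℝ (g x) e * ψ x

theorem IsTest.add {d : ℕ} {Ω : Set (Euc d)} {φ ψ : Euc d → ℝ} (hφ : IsTest Ω φ)
    (hψ : IsTest Ω ψ) : IsTest Ω (φ + ψ) :=
  ⟨hφ.1.add hψ.1, hφ.2.1.add hψ.2.1,
    (tsupport_add φ ψ).trans (union_subset hφ.2.2 hψ.2.2)⟩

theorem IsTest.smul {d : ℕ} {Ω : Set (Euc d)} {φ : Euc d → ℝ} (c : ℝ) (hφ : IsTest Ω φ) :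
    IsTest Ω (c • φ) :=
  ⟨hφ.1.const_smul c, hφ.2.1.smul_left (f := fun _ => c),
    (closure_mono (Function.support_const_smul_subset c φ)).trans hφ.2.2⟩

theorem IsTest.differentiable {d : ℕ} {Ω : Set (Euc d)} {φ : Euc d → ℝ} (hφ : IsTest Ω φ) :
    Differentiable ℝ φ := hφ.1.differentiable (by simp)

/-- The pairs `(φ, ∇φ)` with `φ` in `C₀^∞(Ω)`. -/
def testPairs {d : ℕ} (Ω : Set (Euc d)) : Submodule ℝ (Pairs Ω) where
  carrier := {p | ∃ φ : Euc d → ℝ, IsTest Ω φ ∧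
    p.fst =ᵐ[volume.restrict Ω] φ ∧ p.snd =ᵐ[volume.restrict Ω] gradient φ}
  zero_mem' := by
    refine ⟨0, ⟨contDiff_const, HasCompactSupport.zero, by simp [tsupport]⟩, ?_, ?_⟩
    · exact Lp.coeFn_zero _ _ _
    · have h : gradient (0 : Euc d → ℝ) = 0 := by
        ext1 x; exact gradient_fun_const x 0
      rw [h]; exact Lp.coeFn_zero _ _ _
  add_mem' := by
    rintro p q ⟨φ, hφ, h1, h2⟩ ⟨ψ, hψ, h3, h4⟩
    refine ⟨φ + ψ, hφ.add hψ, ?_, ?_⟩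
    · exact (Lp.coeFn_add p.fst q.fst).trans (h1.add h3)
    · have h : gradient (φ + ψ) = gradient φ + gradient ψ := by
        ext1 x
        simp [gradient, fderiv_add (hφ.differentiable x) (hψ.differentiable x)]
      rw [h]; exact (Lp.coeFn_add p.snd q.snd).trans (h2.add h4)
  smul_mem' := by
    rintro c p ⟨φ, hφ, h1, h2⟩
    refine ⟨c • φ, hφ.smul c, ?_, ?_⟩
    · exact (Lp.coeFn_smul c p.fst).trans (h1.const_smul c)
    · have h : gradient (c • φ) = c • gradient φ := by
        ext1 x
        simp [gradient, fderiv_const_smul (hφ.differentiable x) c]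
      rw [h]; exact (Lp.coeFn_smul c p.snd).trans (h2.const_smul c)

/-- `H¹₀(Ω)`: the closure of `C₀^∞(Ω)` with respect to the `H¹(Ω)`-norm, with that norm. -/
def H10 {d : ℕ} (Ω : Set (Euc d)) : Submodule ℝ (Pairs Ω) := (testPairs Ω).topologicalClosure

/-- The embedding of `H¹₀(Ω)` in `L²(Ω)`. -/
def toL2 {d : ℕ} {Ω : Set (Euc d)} : H10 Ω →L[ℝ] L2 Ω :=
  (WithLp.fstL 2 ℝ (L2 Ω) (L2Vec Ω)).comp (H10 Ω).subtypeL

/-- The gradient `∇ : H¹₀(Ω) → L²(Ω; ℝᵈ)`. -/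
def grad {d : ℕ} {Ω : Set (Euc d)} : H10 Ω →L[ℝ] L2Vec Ω :=
  (WithLp.sndL 2 ℝ (L2 Ω) (L2Vec Ω)).comp (H10 Ω).subtypeL

theorem isWeakGradient_iff_inner {d : ℕ} {Ω : Set (Euc d)} {ψ : Euc d → ℝ} (hψ : IsTest Ω ψ)
    (e : Euc d) : ∃ (a : L2 Ω) (b : L2Vec Ω), ∀ (v : L2 Ω) (g : L2Vec Ω),
      (∫ x in Ω, v x * fderiv ℝ ψ x e = - ∫ x in Ω, inner ℝ (g x) e * ψ x) ↔
        inner ℝ a v + inner ℝ b g = 0 := by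
  have hc1 : Continuous fun x => fderiv ℝ ψ x e :=
    (hψ.1.continuous_fderiv (by simp)).clm_apply continuous_const
  have hs1 : HasCompactSupport fun x => fderiv ℝ ψ x e := hψ.2.1.fderiv_apply ℝ e
  have m1 : MemLp (fun x => fderiv ℝ ψ x e) 2 (volume.restrict Ω) :=
    (hc1.memLp_of_hasCompactSupport hs1).restrict Ω
  have hc2 : Continuous fun x => ψ x • e := hψ.1.continuous.smul continuous_const
  have hs2 : HasCompactSupport fun x => ψ x • e := hψ.2.1.smul_right
  have m2 : MemLp (fun x => ψ x • e) 2 (volume.restrict Ω) :=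
    (hc2.memLp_of_hasCompactSupport hs2).restrict Ω
  refine ⟨m1.toLp _, m2.toLp _, fun v g => ?_⟩
  have e1 : inner ℝ (m1.toLp _) v = ∫ x in Ω, v x * fderiv ℝ ψ x e := by
    rw [L2.inner_def]
    refine integral_congr_ae ?_
    filter_upwards [m1.coeFn_toLp] with x hx
    rw [hx]; simp
  have e2 : inner ℝ (m2.toLp _) g = ∫ x in Ω, inner ℝ (g x) e * ψ x := by
    rw [L2.inner_def]
    refine integral_congr_ae ?_
    filter_upwards [m2.coeFn_toLp] with x hx
    rw [hx, real_inner_comm, inner_smul_right, mul_comm]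
  rw [e1, e2, eq_neg_iff_add_eq_zero]

/-- The second component of an element of `H¹₀(Ω)` is the weak gradient of the first one. -/
theorem isWeakGradient_grad {d : ℕ} {Ω : Set (Euc d)} (v : H10 Ω) :
    IsWeakGradient Ω (toL2 v) (grad v) := by
  intro ψ hψ e
  obtain ⟨a, b, hab⟩ := isWeakGradient_iff_inner hψ e
  rw [hab]
  have hcl : IsClosed {p : Pairs Ω | inner ℝ a (WithLp.fstL 2 ℝ (L2 Ω) (L2Vec Ω) p)
      + inner ℝ b (WithLp.sndL 2 ℝ (L2 Ω) (L2Vec Ω) p) = 0} :=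
    isClosed_eq (by fun_prop) continuous_const
  refine closure_minimal (s := (testPairs Ω : Set (Pairs Ω))) ?_ hcl v.2
  rintro p ⟨φ, hφ, h1, h2⟩
  refine (hab p.fst p.snd).1 ?_
  have i1 : ∫ x in Ω, p.fst x * fderiv ℝ ψ x e = ∫ x in Ω, φ x * fderiv ℝ ψ x e := by
    refine integral_congr_ae ?_
    filter_upwards [h1] with x hx
    rw [hx]
  have i2 : ∫ x in Ω, inner ℝ (p.snd x) e * ψ x = ∫ x in Ω, fderiv ℝ φ x e * ψ x := by
    refine integral_congr_ae ?_
    filter_upwards [h2] with x hx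
    rw [hx, inner_gradient_left]
  have z : ∀ {h : Euc d → ℝ} (k : Euc d → ℝ), tsupport h ⊆ Ω →
      ∫ x in Ω, h x * k x = ∫ x, h x * k x := fun k hh =>
    setIntegral_eq_integral_of_forall_compl_eq_zero fun x hx => by
      rw [image_eq_zero_of_notMem_tsupport fun h' => hx (hh h'), zero_mul]
  have z' : ∫ x in Ω, fderiv ℝ φ x e * ψ x = ∫ x, fderiv ℝ φ x e * ψ x := by
    simp_rw [mul_comm (fderiv ℝ φ _ e)]
    exact z _ hψ.2.2
  have c1 : Continuous fun x => fderiv ℝ φ x e :=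
    (hφ.1.continuous_fderiv (by simp)).clm_apply continuous_const
  have c2 : Continuous fun x => fderiv ℝ ψ x e :=
    (hψ.1.continuous_fderiv (by simp)).clm_apply continuous_const
  rw [i1, i2, z _ hφ.2.2, z']
  exact integral_mul_fderiv_eq_neg_fderiv_mul_of_integrable
    ((c1.mul hψ.1.continuous).integrable_of_hasCompactSupport hψ.2.1.mul_left)
    ((hφ.1.continuous.mul c2).integrable_of_hasCompactSupport hφ.2.1.mul_right)
    ((hφ.1.continuous.mul hψ.1.continuous).integrable_of_hasCompactSupport hψ.2.1.mul_left)
    (fun x _ => hφ.differentiable x) (fun x _ => hψ.differentiable x)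

/-- `H⁻¹(Ω)`, the dual space of `H¹₀(Ω)`. Its elements, topology and measurability structure do not
depend on which of the equivalent norms of `H¹₀(Ω)` is used; see `dualNorm` for its norm. -/
abbrev Hm1 {d : ℕ} (Ω : Set (Euc d)) : Type := StrongDual ℝ (H10 Ω)

/-- The norm of `H⁻¹(Ω)` that is dual to the norm `v ↦ ‖∇v‖` of `H¹₀(Ω)`. -/
def dualNorm {d : ℕ} {Ω : Set (Euc d)} (Φ : Hm1 Ω) : ℝ :=
  sSup {r : ℝ | ∃ v : H10 Ω, v ≠ 0 ∧ r = Φ v / ‖grad v‖}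

/-- The embedding of `L²(Ω)` in `H⁻¹(Ω)`: the functional `v ↦ (w, v)` on `H¹₀(Ω)`. -/
def l2ToDual {d : ℕ} {Ω : Set (Euc d)} (w : L2 Ω) : Hm1 Ω := (innerSL ℝ w).comp toL2

/-! ### Function spaces on the time interval `(0, T)` -/

/-- `v ∈ L²(0, T; V)`. -/
def MemL2Time {V : Type*} [NormedAddCommGroup V] (T : ℝ) (v : ℝ → V) : Prop :=
  MemLp v 2 (volume.restrict (Ioo 0 T))

/-- The norm `(∫₀ᵀ ‖∇v‖² dt)^(1/2)` of `X = L²(0, T; H¹₀(Ω))`. -/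
def normX {d : ℕ} {Ω : Set (Euc d)} (T : ℝ) (v : ℝ → H10 Ω) : ℝ :=
  Real.sqrt (∫ t in Ioo 0 T, ‖grad (v t)‖ ^ 2)

/-- `w` is the weak time derivative of `v` on `(0, T)`. -/
def IsWeakTimeDeriv {V : Type*} [NormedAddCommGroup V] [NormedSpace ℝ V] (T : ℝ) (v w : ℝ → V) :
    Prop :=
  ∀ ψ : ℝ → ℝ, ContDiff ℝ ∞ ψ → HasCompactSupport ψ → tsupport ψ ⊆ Ioo 0 T →
    ∫ t in Ioo 0 T, deriv ψ t • v t = - ∫ t in Ioo 0 T, ψ t • w t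

/-- `w ∈ L²(0, T; H⁻¹(Ω))` is the weak time derivative of `φ`, after embedding the values of `φ` in
`H⁻¹(Ω)`. -/
def HasTimeDeriv {d : ℕ} {Ω : Set (Euc d)} (T : ℝ) (φ : ℝ → H10 Ω) (w : ℝ → Hm1 Ω) : Prop :=
  MemL2Time T w ∧ IsWeakTimeDeriv T (fun t => l2ToDual (toL2 (φ t))) w

/-- `φ ∈ Y = L²(0, T; H¹₀(Ω)) ∩ H¹(0, T; H⁻¹(Ω))`. -/
def MemY {d : ℕ} {Ω : Set (Euc d)} (T : ℝ) (φ : ℝ → H10 Ω) : Prop :=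
  MemL2Time T φ ∧ ∃ w, HasTimeDeriv T φ w

open Classical in
/-- The weak time derivative `∂ₜφ` in `L²(0, T; H⁻¹(Ω))` of an element `φ` of `Y`. It is unique up
to equality almost everywhere. -/
def timeDeriv {d : ℕ} {Ω : Set (Euc d)} (T : ℝ) (φ : ℝ → H10 Ω) : ℝ → Hm1 Ω :=
  if h : ∃ w, HasTimeDeriv T φ w then h.choose else 0

/-- `φ(s) = g` for the representative of `φ` in `C([0, T]; L²(Ω))`. -/
def HasTimeValue {d : ℕ} {Ω : Set (Euc d)} (T : ℝ) (φ : ℝ → H10 Ω) (s : ℝ) (g : L2 Ω) : Prop :=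
  ∃ c : ℝ → L2 Ω, ContinuousOn c (Icc 0 T) ∧
    (∀ᵐ t ∂(volume.restrict (Ioo 0 T)), c t = toL2 (φ t)) ∧ c s = g

open Classical in
/-- The value `φ(s)` in `L²(Ω)`, for `s` in `[0, T]`, of an element `φ` of `Y`, by the embedding of
`Y` in `C([0, T]; L²(Ω))`. -/
def timeValue {d : ℕ} {Ω : Set (Euc d)} (T : ℝ) (φ : ℝ → H10 Ω) (s : ℝ) : L2 Ω :=
  if h : ∃ g, HasTimeValue T φ s g then h.choose else 0

/-- `φ ∈ Y_T`, that is, `φ ∈ Y` and `φ(T) = 0`. -/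
def MemYT {d : ℕ} {Ω : Set (Euc d)} (T : ℝ) (φ : ℝ → H10 Ω) : Prop :=
  MemY T φ ∧ HasTimeValue T φ T 0

/-- The norm `(∫₀ᵀ (‖∂ₜφ‖²_{H⁻¹} + ‖∇φ‖²) dt + ‖φ(0)‖²)^(1/2)` of `Y_T`. -/
def normYT {d : ℕ} {Ω : Set (Euc d)} (T : ℝ) (φ : ℝ → H10 Ω) : ℝ :=
  Real.sqrt ((∫ t in Ioo 0 T, (dualNorm (timeDeriv T φ t) ^ 2 + ‖grad (φ t)‖ ^ 2))
    + ‖timeValue T φ 0‖ ^ 2)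

/-- The quotients `∫₀ᵀ ⟨F, φ⟩ dt / ‖φ‖_{Y_T}` for `φ ∈ Y_T \ {0}`. -/
def dualQuotientsYT {d : ℕ} {Ω : Set (Euc d)} (T : ℝ) (F : ℝ → Hm1 Ω) : Set ℝ :=
  {r : ℝ | ∃ φ : ℝ → H10 Ω, MemYT T φ ∧ ¬ (φ =ᵐ[volume.restrict (Ioo 0 T)] 0) ∧
    r = (∫ t in Ioo 0 T, F t (φ t)) / normYT T φ}

/-- `u ∈ Y` is the weak solution of `∂ₜu - Δu = f` in `Ω × (0, T)`, `u = 0` on `∂Ω × (0, T)`,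
`u(0) = u₀`. -/
def IsWeakSolution {d : ℕ} {Ω : Set (Euc d)} (T : ℝ) (f : ℝ → Hm1 Ω) (u₀ : L2 Ω)
    (u : ℝ → H10 Ω) : Prop :=
  MemY T u ∧
  (∀ᵐ t ∂(volume.restrict (Ioo 0 T)), ∀ v : H10 Ω,
    timeDeriv T u t v + inner ℝ (grad (u t)) (grad v) = f t v) ∧
  HasTimeValue T u 0 u₀

/-! ### Implicit Euler discretization in time -/

/-- Time-step points `0 = t₀ < t₁ < ... < t_N = T`. -/
structure TimeGrid (T : ℝ) (N : ℕ) where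
  pt : Fin (N + 1) → ℝ
  strictMono : StrictMono pt
  first : pt 0 = 0
  last : pt (Fin.last N) = T

namespace TimeGrid

variable {T : ℝ} {N : ℕ} (G : TimeGrid T N)

/-- The step length `tₙ - tₙ₋₁`; here and below `n : Fin N` stands for the step from
`n.castSucc` to `n.succ`. -/
def step (n : Fin N) : ℝ := G.pt n.succ - G.pt n.castSucc

/-- The function on `[0, T]` that equals `g n` on `(tₙ₋₁, tₙ]` and `g₀` at time `0`. -/
def glue {E : Type*} [AddCommMonoid E] (g₀ : E) (g : Fin N → ℝ → E) (s : ℝ) : E :=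
  ({0} : Set ℝ).indicator (fun _ => g₀) s +
    ∑ n, (Ioc (G.pt n.castSucc) (G.pt n.succ)).indicator (g n) s

theorem glue_zero {E : Type*} [AddCommMonoid E] (g₀ : E) (g : Fin N → ℝ → E) :
    G.glue g₀ g 0 = g₀ := by
  have h : ∀ n : Fin N, (Ioc (G.pt n.castSucc) (G.pt n.succ)).indicator (g n) 0 = 0 := fun n =>
    indicator_of_notMem (fun hn => by
      have := G.strictMono.monotone (Fin.zero_le n.castSucc)
      rw [G.first] at this
      exact absurd hn.1 (not_lt.2 this)) _
  simp [glue, h]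

theorem glue_of_mem {E : Type*} [AddCommMonoid E] (g₀ : E) (g : Fin N → ℝ → E) {n : Fin N} {s : ℝ}
    (hs : s ∈ Ioc (G.pt n.castSucc) (G.pt n.succ)) : G.glue g₀ g s = g n s := by
  have h0 : s ∉ ({0} : Set ℝ) := by
    have := G.strictMono.monotone (Fin.zero_le n.castSucc)
    rw [G.first] at this
    exact fun h => absurd (h ▸ hs.1) (not_lt.2 this)
  have h : ∀ m : Fin N, m ≠ n →
      (Ioc (G.pt m.castSucc) (G.pt m.succ)).indicator (g m) s = 0 := by
    intro m hm
    refine indicator_of_notMem (fun hms => ?_) _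
    rcases lt_or_gt_of_ne hm with hlt | hlt
    · have : G.pt m.succ ≤ G.pt n.castSucc :=
        G.strictMono.monotone (Fin.succ_le_castSucc_iff.2 hlt)
      linarith [hms.2, hs.1]
    · have : G.pt n.succ ≤ G.pt m.castSucc :=
        G.strictMono.monotone (Fin.succ_le_castSucc_iff.2 hlt)
      linarith [hms.1, hs.2]
  rw [glue, indicator_of_notMem h0, zero_add, Finset.sum_eq_single n (fun m _ hm => h m hm)
    (fun hn => absurd (Finset.mem_univ n) hn), indicator_of_mem hs]

/-- The mean value of `f` over the time interval `(tₙ₋₁, tₙ)`. -/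
def mean {E : Type*} [NormedAddCommGroup E] [NormedSpace ℝ E] (f : ℝ → E) (n : Fin N) : E :=
  (G.step n)⁻¹ • ∫ s in Ioo (G.pt n.castSucc) (G.pt n.succ), f s

/-- The temporal mean-value approximation `f_τ` of `f`, equal to `G.mean f n` on `(tₙ₋₁, tₙ)`. -/
def meanApprox {E : Type*} [NormedAddCommGroup E] [NormedSpace ℝ E] (f : ℝ → E) : ℝ → E :=
  G.glue 0 (fun n _ => G.mean f n)

/-- `U 0, ..., U N` is the implicit Euler approximation with the mean values of `f` as data. -/
def IsImplicitEuler {d : ℕ} {Ω : Set (Euc d)} (f : ℝ → Hm1 Ω) (u₀ : H10 Ω)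
    (U : Fin (N + 1) → H10 Ω) : Prop :=
  U 0 = u₀ ∧ ∀ (n : Fin N) (v : H10 Ω),
    inner ℝ ((G.step n)⁻¹ • (toL2 (U n.succ) - toL2 (U n.castSucc))) (toL2 v)
      + inner ℝ (grad (U n.succ)) (grad v) = G.mean f n v

/-- The left-continuous piecewise constant reconstruction `u_τ`, with value `U n` on
`(tₙ₋₁, tₙ]` and `U 0` at time `0`. -/
def pwConst {E : Type*} [NormedAddCommGroup E] (U : Fin (N + 1) → E) : ℝ → E :=
  G.glue (U 0) (fun n _ => U n.succ)

/-- The continuous piecewise affine reconstruction `U_τ`, with value `U n` at time `tₙ`. -/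
def pwAffine {E : Type*} [NormedAddCommGroup E] [NormedSpace ℝ E] (U : Fin (N + 1) → E) : ℝ → E :=
  G.glue (U 0) (fun n s => ((s - G.pt n.castSucc) / G.step n) • U n.succ
    + ((G.pt n.succ - s) / G.step n) • U n.castSucc)

/-- The temporal jump estimator `η_J = ‖u_τ - U_τ‖_X`. -/
def jumpEstimator {d : ℕ} {Ω : Set (Euc d)} (U : Fin (N + 1) → H10 Ω) : ℝ :=
  normX T (G.pwConst U - G.pwAffine U)

/-- The data oscillation `η_{osc,τ,X}`, the supremum of `∫₀ᵀ ⟨f - f_τ, φ⟩ dt / ‖φ‖_{Y_T}` over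
`φ ∈ Y_T \ {0}`. -/
def oscX {d : ℕ} {Ω : Set (Euc d)} (f : ℝ → Hm1 Ω) : ℝ :=
  sSup (dualQuotientsYT T (f - G.meanApprox f))

end TimeGrid

end ParabolicHeat

end

open MeasureTheory Set
open scoped ContDiff

noncomputable section

namespace ParabolicHeat

/-! The proof is a duality argument with stability constant one. Let `R` be the Riesz map of the
Dirichlet form, so that `(∇RΦ, ∇v) = ⟨Φ, v⟩`; it exists by the Poincaré inequality and Lax-Milgram,
and `‖Φ‖_{H⁻¹} = ‖∇RΦ‖`. Let `φ` be a `C¹` curve in `H¹₀(Ω)` with `φ(T) = 0`. In `‖φ - R∂ₜφ‖_X²` the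
cross term is `-∫ d/dt ‖φ‖²_Ω = ‖φ(0)‖²_Ω`, hence `‖φ - R∂ₜφ‖_X = ‖φ‖_{Y_T}`
(`timeNorm_sub_riesz_sq`, `IsTestCurve.normYT_eq`).

The functions `φ - R∂ₜφ` are dense in `L²(0,T;H¹₀(Ω))` (`adjointRange_dense`), because an element
orthogonal to all of them yields a very weak solution of the heat equation with zero data, and such
a solution vanishes (`ae_eq_zero_of_forall_testCurve`). Therefore `‖e‖_X ≤ M` as soon as `∫ (∇e,∇φ)
- (e,∂ₜφ) ≤ M ‖φ‖_{Y_T}` for all these curves (`timeNorm_le_of_forall_testCurve`). Density of smooth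
functions in `Y_T` is never needed.

Integration by parts in time gives `∫ (∇u,∇φ) - (u,∂ₜφ) = ∫ ⟨f,φ⟩ + (u₀,φ(0))` and `∫ (∇u_τ,∇φ) -
(U_τ,∂ₜφ) = ∫ ⟨f_τ,φ⟩ + (u₀,φ(0))`. The difference of the right-hand sides is at most `η_osc
‖φ‖_{Y_T}`. Replacing `U_τ` by `u_τ` on the left costs `∫ (u_τ - U_τ, ∂ₜφ) ≤ η_J ‖R∂ₜφ‖_X`, and
replacing `u_τ` by `U_τ` costs `∫ (∇(u_τ - U_τ), ∇φ) ≤ η_J ‖φ‖_X`. Both are at most `η_J ‖φ‖_{Y_T}`,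
which gives the two estimates (`timeNorm_sub_le_of_residual_le`). -/

/-! ### Poincaré inequality and the Riesz map of the Dirichlet form. -/

theorem norm_fst_le_of_mem_testPairs {d : ℕ} (hd : 1 ≤ d) {Ω : Set (Euc d)} {r : ℝ}
    (hΩ : MeasurableSet Ω) (hr0 : 0 ≤ r) (hr : ∀ x ∈ Ω, ‖x‖ ≤ r) {p : Pairs Ω}
    (hp : p ∈ testPairs Ω) : ‖p.fst‖ ≤ 2 * r * ‖p.snd‖ := by
  obtain ⟨φ, hφ, h1, h2⟩ := hp
  let i : Fin d := ⟨0, hd⟩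
  let e : Euc d := EuclideanSpace.single i 1
  have he : ‖e‖ = 1 := by simp [e]
  have hcφ : Continuous φ := hφ.1.continuous
  have hcoord : Continuous fun x : Euc d => x i := by fun_prop
  have hcd : Continuous fun x => fderiv ℝ φ x e :=
    (hφ.1.continuous_fderiv (by simp)).clm_apply continuous_const
  have hm : MemLp (fun x => (φ x * x i) • e) 2 (volume.restrict Ω) :=
    (((hcφ.mul hcoord).smul continuous_const).memLp_of_hasCompactSupport
      (hφ.2.1.mul_right.smul_right)).restrict Ω
  have hz : ∀ {h : Euc d → ℝ}, (∀ x, φ x = 0 → h x = 0) → ∫ x in Ω, h x = ∫ x, h x := fun hh =>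
    setIntegral_eq_integral_of_forall_compl_eq_zero fun x hx =>
      hh x (image_eq_zero_of_notMem_tsupport fun h' => hx (hφ.2.2 h'))
  have hsq : ∀ x, HasFDerivAt (fun x => φ x * φ x) (φ x • fderiv ℝ φ x + φ x • fderiv ℝ φ x) x :=
    fun x => (hφ.differentiable x).hasFDerivAt.mul (hφ.differentiable x).hasFDerivAt
  have hco : ∀ x : Euc d, HasFDerivAt (fun x : Euc d => x i)
      (EuclideanSpace.proj i : Euc d →L[ℝ] ℝ) x := fun x =>
    (EuclideanSpace.proj i : Euc d →L[ℝ] ℝ).hasFDerivAt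
  have hf1 : ∀ x, fderiv ℝ (fun x => φ x * φ x) x e = 2 * (φ x * fderiv ℝ φ x e) := by
    intro x; rw [(hsq x).fderiv]; simp; ring
  have hf2 : ∀ x : Euc d, fderiv ℝ (fun x : Euc d => x i) x e = 1 := by
    intro x; rw [(hco x).fderiv]; simp [e]
  -- Since `∂ᵢxᵢ = 1`, integrating `φ² ∂ᵢxᵢ` by parts gives `∫ φ² = -2 ∫ φ ∂ᵢφ xᵢ`. With `|xᵢ| ≤ r`
  -- on `Ω`, Cauchy-Schwarz yields the constant `2r`.
  have key := integral_mul_fderiv_eq_neg_fderiv_mul_of_integrable (μ := (volume : Measure (Euc d)))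
    (f := fun x => φ x * φ x) (g := fun x : Euc d => x i) (v := e)
    (by simp_rw [hf1]
        exact ((continuous_const.mul (hcφ.mul hcd)).mul hcoord).integrable_of_hasCompactSupport
          (hφ.2.1.mul_right.mul_left.mul_right))
    (by simp_rw [hf2]
        exact ((hcφ.mul hcφ).mul continuous_const).integrable_of_hasCompactSupport
          (hφ.2.1.mul_right.mul_right))
    (((hcφ.mul hcφ).mul hcoord).integrable_of_hasCompactSupport (hφ.2.1.mul_right.mul_right))
    (fun x _ => (hsq x).differentiableAt) (fun x _ => (hco x).differentiableAt)
  simp_rw [hf1, hf2, mul_one] at key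
  have e1 : ‖p.fst‖ ^ 2 = ∫ x, φ x * φ x := by
    rw [← real_inner_self_eq_norm_sq, L2.inner_def, ← hz (fun x hx => by simp [hx])]
    refine integral_congr_ae ?_
    filter_upwards [h1] with x hx
    rw [hx]; simp [sq]
  have e2 : inner ℝ (hm.toLp _) p.snd = ∫ x, φ x * fderiv ℝ φ x e * x i := by
    rw [L2.inner_def, ← hz (fun x hx => by simp [hx])]
    refine integral_congr_ae ?_
    filter_upwards [hm.coeFn_toLp, h2] with x hx hx2
    rw [hx, hx2, inner_smul_left, real_inner_comm, inner_gradient_left]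
    simp; ring
  have e3 : ‖hm.toLp _‖ ≤ r * ‖p.fst‖ := by
    refine Lp.norm_le_mul_norm_of_ae_le_mul ?_
    filter_upwards [hm.coeFn_toLp, h1, ae_restrict_mem hΩ] with x hx hx1 hxΩ
    rw [hx, hx1, norm_smul, he, mul_one, norm_mul, mul_comm]
    gcongr
    exact (PiLp.norm_apply_le x i).trans (hr x hxΩ)
  have e4 : ‖p.fst‖ ^ 2 = -(2 * inner ℝ (hm.toLp _) p.snd) := by
    rw [e1, key, e2, ← integral_const_mul]
    congr 2; ext x; ring
  have e5 : ‖p.fst‖ ^ 2 ≤ 2 * (r * ‖p.fst‖ * ‖p.snd‖) := by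
    rw [e4]
    have := (abs_le.1 (abs_real_inner_le_norm (hm.toLp _) p.snd)).1
    have := mul_le_mul_of_nonneg_right e3 (norm_nonneg p.snd)
    linarith
  rcases (norm_nonneg p.fst).eq_or_lt with h0 | h0
  · rw [← h0]; positivity
  · refine le_of_mul_le_mul_left ?_ h0
    nlinarith

/-- The Poincaré inequality on `H¹₀(Ω)`. -/
theorem exists_norm_toL2_le {d : ℕ} (hd : 1 ≤ d) {Ω : Set (Euc d)} (hΩ : IsOpen Ω)
    (hΩb : Bornology.IsBounded Ω) :
    ∃ C : ℝ, 0 ≤ C ∧ ∀ v : H10 Ω, ‖toL2 v‖ ≤ C * ‖grad v‖ := by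
  obtain ⟨r, hr0, hr⟩ := hΩb.exists_pos_norm_le
  refine ⟨2 * r, by positivity, fun v => ?_⟩
  have hcl : IsClosed {p : Pairs Ω | ‖WithLp.fstL 2 ℝ (L2 Ω) (L2Vec Ω) p‖ ≤
      2 * r * ‖WithLp.sndL 2 ℝ (L2 Ω) (L2Vec Ω) p‖} :=
    isClosed_le (by fun_prop) (by fun_prop)
  exact closure_minimal (s := (testPairs Ω : Set (Pairs Ω)))
    (fun p hp => norm_fst_le_of_mem_testPairs hd hΩ.measurableSet hr0.le hr hp) hcl v.2

theorem norm_sq_H10 {d : ℕ} {Ω : Set (Euc d)} (v : H10 Ω) :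
    ‖v‖ ^ 2 = ‖toL2 v‖ ^ 2 + ‖grad v‖ ^ 2 :=
  WithLp.prod_norm_sq_eq_of_L2 (v : Pairs Ω)

instance {d : ℕ} {Ω : Set (Euc d)} : CompleteSpace (H10 Ω) :=
  (Submodule.isClosed_topologicalClosure _).completeSpace_coe

/-- The Dirichlet form `(∇v, ∇w)` as an operator `H¹₀(Ω) → H⁻¹(Ω)`. -/
def negLaplace {d : ℕ} (Ω : Set (Euc d)) : H10 Ω →L[ℝ] Hm1 Ω :=
  (innerSL ℝ).bilinearComp grad grad

theorem negLaplace_apply {d : ℕ} {Ω : Set (Euc d)} (v w : H10 Ω) :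
    negLaplace Ω v w = inner ℝ (grad v) (grad w) := rfl

/-- The Lax-Milgram theorem, as the existence of a continuous right inverse. -/
theorem _root_.IsCoercive.exists_rightInverse {V : Type*} [NormedAddCommGroup V]
    [InnerProductSpace ℝ V] [CompleteSpace V] {B : V →L[ℝ] StrongDual ℝ V} (hB : IsCoercive B) :
    ∃ R : StrongDual ℝ V →L[ℝ] V, ∀ Φ, B (R Φ) = Φ := by
  have hE : ∀ v w, B v w = inner ℝ (hB.continuousLinearEquivOfBilin v) w := fun v w =>
    (hB.continuousLinearEquivOfBilin_apply v w).symm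
  have hker : B.ker = ⊥ := by
    refine LinearMap.ker_eq_bot'.2 fun v hv => ?_
    refine hB.continuousLinearEquivOfBilin.map_eq_zero_iff.1 (ext_inner_right ℝ fun w => ?_)
    have hv' : B v = 0 := hv
    rw [← hE, hv', inner_zero_left]; rfl
  have hrange : B.range = ⊤ := by
    refine LinearMap.range_eq_top.2 fun Φ => ?_
    refine ⟨hB.continuousLinearEquivOfBilin.symm ((InnerProductSpace.toDual ℝ V).symm Φ),
      ContinuousLinearMap.ext fun w => ?_⟩
    refine (hE _ _).trans ?_
    rw [ContinuousLinearEquiv.apply_symm_apply]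
    exact InnerProductSpace.toDual_symm_apply
  exact ⟨(ContinuousLinearEquiv.ofBijective B hker hrange).symm,
    (ContinuousLinearEquiv.ofBijective B hker hrange).apply_symm_apply⟩

/-- The Riesz isomorphism of `H⁻¹(Ω)` and `H¹₀(Ω)` for the Dirichlet form. -/
theorem exists_riesz {d : ℕ} (hd : 1 ≤ d) {Ω : Set (Euc d)} (hΩ : IsOpen Ω)
    (hΩb : Bornology.IsBounded Ω) :
    ∃ R : Hm1 Ω →L[ℝ] H10 Ω, ∀ (Φ : Hm1 Ω) (v : H10 Ω),
      inner ℝ (grad (R Φ)) (grad v) = Φ v := by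
  obtain ⟨C, hC0, hC⟩ := exists_norm_toL2_le hd hΩ hΩb
  have hco : IsCoercive (negLaplace Ω) := by
    -- The Poincaré inequality gives `‖v‖² ≤ (C² + 1) ‖∇v‖²` for the full `H¹` norm.
    refine ⟨(C ^ 2 + 1)⁻¹, by positivity, fun v => ?_⟩
    rw [negLaplace_apply, real_inner_self_eq_norm_sq, mul_assoc, ← sq,
      inv_mul_le_iff₀ (by positivity), norm_sq_H10]
    have := pow_le_pow_left₀ (norm_nonneg _) (hC v) 2
    nlinarith
  obtain ⟨R, hR⟩ := hco.exists_rightInverse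
  refine ⟨R, fun Φ v => ?_⟩
  rw [← negLaplace_apply, hR]

section Riesz

variable {d : ℕ} {Ω : Set (Euc d)} {R : Hm1 Ω →L[ℝ] H10 Ω}

theorem grad_injective (hd : 1 ≤ d) (hΩ : IsOpen Ω) (hΩb : Bornology.IsBounded Ω) {v : H10 Ω}
    (h : grad v = 0) : v = 0 := by
  obtain ⟨C, -, hC⟩ := exists_norm_toL2_le hd hΩ hΩb
  have h1 := hC v
  rw [h, norm_zero, mul_zero] at h1
  have h2 := norm_sq_H10 v
  rw [h, le_antisymm h1 (norm_nonneg _)] at h2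
  simpa using h2

/-- Cauchy-Schwarz for the Dirichlet form, with equality at `v = RΦ`. -/
theorem dualNorm_eq (hd : 1 ≤ d) (hΩ : IsOpen Ω) (hΩb : Bornology.IsBounded Ω)
    (hR : ∀ (Φ : Hm1 Ω) (v : H10 Ω), inner ℝ (grad (R Φ)) (grad v) = Φ v) (Φ : Hm1 Ω) :
    dualNorm Φ = ‖grad (R Φ)‖ := by
  have hub : ∀ r ∈ {r : ℝ | ∃ v : H10 Ω, v ≠ 0 ∧ r = Φ v / ‖grad v‖}, r ≤ ‖grad (R Φ)‖ := by
    rintro _ ⟨v, -, rfl⟩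
    refine div_le_of_le_mul₀ (norm_nonneg _) (norm_nonneg _) ?_
    rw [← hR]
    exact real_inner_le_norm _ _
  refine le_antisymm (Real.sSup_le hub (norm_nonneg _)) ?_
  -- Here `Φ = 0` and there may be no admissible `v` at all; the supremum is nonnegative in either
  -- case.
  by_cases h : R Φ = 0
  · rw [h, map_zero, norm_zero]
    by_contra! hn
    have h0 : ∀ v, Φ v = 0 := fun v => by rw [← hR, h]; simp
    have : 0 ≤ dualNorm Φ := Real.sSup_nonneg (by rintro _ ⟨v, -, rfl⟩; simp [h0])
    linarith
  · refine le_csSup ⟨_, hub⟩ ⟨R Φ, h, ?_⟩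
    have hg : ‖grad (R Φ)‖ ≠ 0 := fun h' => h (grad_injective hd hΩ hΩb (norm_eq_zero.1 h'))
    rw [← hR, real_inner_self_eq_norm_sq]
    field_simp

end Riesz

/-! ### Vector-valued functions of time: primitives, integration by parts, weak derivatives. -/

section Time

variable {E F G : Type*} [NormedAddCommGroup E] [NormedSpace ℝ E] [NormedAddCommGroup F]
  [NormedSpace ℝ F] [NormedAddCommGroup G] [NormedSpace ℝ G] {T : ℝ}

theorem integrable_bilin_prod (L : E →L[ℝ] F →L[ℝ] G) {α β : Type*} [MeasurableSpace α]
    [MeasurableSpace β] {μ : Measure α} {ν : Measure β} [SFinite μ] [SFinite ν] {g : α → F}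
    {w : β → E} (hg : Integrable g μ) (hw : Integrable w ν) :
    Integrable (fun p : α × β => L (w p.2) (g p.1)) (μ.prod ν) := by
  refine ((hg.norm.mul_prod hw.norm).const_mul ‖L‖).mono'
    (L.aestronglyMeasurable_comp₂ hw.aestronglyMeasurable.comp_snd
      hg.aestronglyMeasurable.comp_fst) (Filter.Eventually.of_forall fun p => ?_)
  refine (L.le_opNorm₂ _ _).trans_eq ?_
  ring

theorem continuousOn_primitive_Ioo {w : ℝ → E} (hw : IntegrableOn w (Ioo 0 T)) :
    ContinuousOn (fun t => ∫ s in Ioo 0 t, w s) (Icc 0 T) := by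
  simp_rw [← integral_Ioc_eq_integral_Ioo]
  exact intervalIntegral.continuousOn_primitive ((integrableOn_Icc_iff_integrableOn_Ioo).2 hw)

theorem norm_primitive_Ioo_le {w : ℝ → E} (hw : IntegrableOn w (Ioo 0 T)) {t : ℝ} (ht : t ≤ T) :
    ‖∫ s in Ioo 0 t, w s‖ ≤ ∫ s in Ioo 0 T, ‖w s‖ :=
  (norm_integral_le_integral_norm _).trans
    (setIntegral_mono_set hw.norm (Filter.Eventually.of_forall fun _ => norm_nonneg _)
      (Ioo_subset_Ioo_right ht).eventuallyLE)

theorem aestronglyMeasurable_primitive_Ioo {w : ℝ → E} (hw : IntegrableOn w (Ioo 0 T)) :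
    AEStronglyMeasurable (fun t => ∫ s in Ioo 0 t, w s) (volume.restrict (Ioo 0 T)) :=
  ((continuousOn_primitive_Ioo hw).mono Ioo_subset_Icc_self).aestronglyMeasurable measurableSet_Ioo

theorem integrableOn_primitive_Ioo {w : ℝ → E} (hw : IntegrableOn w (Ioo 0 T)) :
    IntegrableOn (fun t => ∫ s in Ioo 0 t, w s) (Ioo 0 T) :=
  ((continuousOn_primitive_Ioo hw).integrableOn_Icc).mono_set Ioo_subset_Icc_self

theorem integrableOn_bilin_primitive (L : E →L[ℝ] F →L[ℝ] G) {w : ℝ → E} {g : ℝ → F}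
    (hw : IntegrableOn w (Ioo 0 T)) (hg : IntegrableOn g (Ioo 0 T)) :
    IntegrableOn (fun t => L (∫ s in Ioo 0 t, w s) (g t)) (Ioo 0 T) := by
  refine (hg.norm.const_mul (‖L‖ * ∫ s in Ioo 0 T, ‖w s‖)).mono'
    (L.aestronglyMeasurable_comp₂ (aestronglyMeasurable_primitive_Ioo hw)
      hg.aestronglyMeasurable) ?_
  filter_upwards [ae_restrict_mem measurableSet_Ioo] with t ht
  refine (L.le_opNorm₂ _ _).trans ?_
  gcongr
  exact norm_primitive_Ioo_le hw ht.2.le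

/-- Integration by parts on `(0, T)`, in the form of Fubini's theorem on a triangle. -/
theorem integral_bilin_primitive [CompleteSpace E] [CompleteSpace F] [CompleteSpace G]
    (L : E →L[ℝ] F →L[ℝ] G) {w : ℝ → E} {g : ℝ → F}
    (hw : IntegrableOn w (Ioo 0 T)) (hg : IntegrableOn g (Ioo 0 T)) :
    ∫ t in Ioo 0 T, L (∫ s in Ioo 0 t, w s) (g t) =
      ∫ s in Ioo 0 T, L (w s) (∫ t in Ioo s T, g t) := by
  have hm : MeasurableSet {p : ℝ × ℝ | p.2 < p.1} := measurableSet_lt measurable_snd measurable_fst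
  have hint := (integrable_bilin_prod L hg hw).indicator hm
  have hswap := integral_integral_swap
    (f := fun t s => {p : ℝ × ℝ | p.2 < p.1}.indicator (fun p => L (w p.2) (g p.1)) (t, s)) hint
  refine Eq.trans (setIntegral_congr_fun measurableSet_Ioo fun t ht => ?_)
    (hswap.trans (setIntegral_congr_fun measurableSet_Ioo fun s hs => ?_))
  · have h1 : (fun s => {p : ℝ × ℝ | p.2 < p.1}.indicator (fun p => L (w p.2) (g p.1)) (t, s)) =
        (Iio t).indicator fun s => L.flip (g t) (w s) := by
      ext s; simp [indicator]
    have h2 : Ioo 0 T ∩ Iio t = Ioo 0 t := by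
      ext s; simp only [mem_inter_iff, mem_Ioo, mem_Iio]
      exact ⟨fun h => ⟨h.1.1, h.2⟩, fun h => ⟨⟨h.1, h.2.trans ht.2⟩, h.2⟩⟩
    simp only [h1]
    rw [setIntegral_indicator measurableSet_Iio, h2, (L.flip (g t)).integral_comp_comm
      (hw.mono_set (Ioo_subset_Ioo_right ht.2.le))]
    rfl
  · have h1 : (fun t => {p : ℝ × ℝ | p.2 < p.1}.indicator (fun p => L (w p.2) (g p.1)) (t, s)) =
        (Ioi s).indicator fun t => L (w s) (g t) := by
      ext t; simp [indicator]
    have h2 : Ioo 0 T ∩ Ioi s = Ioo s T := by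
      ext t; simp only [mem_inter_iff, mem_Ioo, mem_Ioi]
      exact ⟨fun h => ⟨h.2, h.1.2⟩, fun h => ⟨⟨hs.1.trans h.1, h.2⟩, h.1⟩⟩
    simp only [h1]
    rw [setIntegral_indicator measurableSet_Ioi, h2, (L (w s)).integral_comp_comm
      (hg.mono_set (Ioo_subset_Ioo_left hs.1.le))]

theorem setIntegral_Ioo_deriv [CompleteSpace E] {φ φ' : ℝ → E} (h : ∀ t, HasDerivAt φ (φ' t) t)
    (hc : Continuous φ') {a b : ℝ} (hab : a ≤ b) : ∫ t in Ioo a b, φ' t = φ b - φ a := by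
  rw [← integral_Ioc_eq_integral_Ioo, ← intervalIntegral.integral_of_le hab]
  exact intervalIntegral.integral_eq_sub_of_hasDerivAt (fun t _ => h t) (hc.intervalIntegrable _ _)

theorem _root_.Continuous.integrableOn_Ioo {E : Type*} [NormedAddCommGroup E] {φ : ℝ → E}
    (h : Continuous φ) {a b : ℝ} :
    IntegrableOn φ (Ioo a b) :=
  (h.integrableOn_Icc).mono_set Ioo_subset_Icc_self

theorem _root_.MeasureTheory.IntegrableOn.continuous_smul {h : ℝ → E} {a b : ℝ}
    (hh : IntegrableOn h (Ioo a b)) {ψ : ℝ → ℝ} (hψ : Continuous ψ) :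
    IntegrableOn (fun t => ψ t • h t) (Ioo a b) := by
  obtain ⟨C, hC⟩ := isCompact_Icc.exists_bound_of_continuousOn (hψ.continuousOn (s := Icc a b))
  refine hh.bdd_smul C hψ.aestronglyMeasurable.restrict ?_
  filter_upwards [ae_restrict_mem measurableSet_Ioo] with t ht
  exact hC t (Ioo_subset_Icc_self ht)

/-- The integral is `½ ‖∫₀ᵀ w‖²`: Fubini turns it into the integral over the complementary triangle,
and the two triangles add up to the square. -/
theorem integral_inner_primitive_nonneg {E : Type*} [NormedAddCommGroup E] [InnerProductSpace ℝ E]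
    [CompleteSpace E] {w : ℝ → E} (hw : IntegrableOn w (Ioo 0 T)) :
    0 ≤ ∫ t in Ioo 0 T, inner ℝ (∫ s in Ioo 0 t, w s) (w t) := by
  have h1 := integral_bilin_primitive (innerSL ℝ) hw hw
  have h2 : ∀ t ∈ Ioo 0 T, innerSL ℝ (w t) (∫ s in Ioo t T, w s) =
      innerSL ℝ (∫ s in Ioo 0 T, w s) (w t) - innerSL ℝ (∫ s in Ioo 0 t, w s) (w t) := by
    intro t ht
    have hsplit : ∫ s in Ioo 0 T, w s = (∫ s in Ioo 0 t, w s) + ∫ s in Ioo t T, w s := by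
      rw [← Ioc_union_Ioo_eq_Ioo ht.1.le ht.2, setIntegral_union
        (disjoint_left.2 fun x hx hx' => not_lt.2 hx.2 hx'.1) measurableSet_Ioo
        (hw.mono_set fun x hx => ⟨hx.1, hx.2.trans_lt ht.2⟩)
        (hw.mono_set (Ioo_subset_Ioo_left ht.1.le)), integral_Ioc_eq_integral_Ioo]
    rw [hsplit, map_add]
    simp [real_inner_comm]
  rw [setIntegral_congr_fun measurableSet_Ioo h2, integral_sub
    ((innerSL ℝ _).integrable_comp hw) (integrableOn_bilin_primitive (innerSL ℝ) hw hw),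
    (innerSL ℝ _).integral_comp_comm hw] at h1
  simp only [innerSL_apply_apply ℝ, real_inner_self_eq_norm_sq] at h1
  have := sq_nonneg ‖∫ s in Ioo 0 T, w s‖
  linarith

/-- The primitive from `0` vanishes to the left of the support of `θ`, and to its right because `θ`
has mean zero. -/
theorem exists_contDiff_deriv_eq {θ : ℝ → ℝ} (hT : 0 < T) (h1 : ContDiff ℝ ∞ θ)
    (h2 : HasCompactSupport θ) (h3 : tsupport θ ⊆ Ioo 0 T) (h0 : ∫ t in Ioo 0 T, θ t = 0) :
    ∃ ψ : ℝ → ℝ, ContDiff ℝ ∞ ψ ∧ HasCompactSupport ψ ∧ tsupport ψ ⊆ Ioo 0 T ∧ deriv ψ = θ := by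
  have hd : ∀ t, HasDerivAt (fun t => ∫ s in (0 : ℝ)..t, θ s) (θ t) t := fun t =>
    h1.continuous.integral_hasStrictDerivAt 0 t |>.hasDerivAt
  have hder : deriv (fun t => ∫ s in (0 : ℝ)..t, θ s) = θ := funext fun t => (hd t).deriv
  -- The point `T / 2` only serves to make the compact set nonempty when `θ = 0`.
  have hK : IsCompact (tsupport θ ∪ {T / 2}) := h2.isCompact.union isCompact_singleton
  have hKI : tsupport θ ∪ {T / 2} ⊆ Ioo 0 T :=
    union_subset h3 (singleton_subset_iff.2 ⟨by linarith, by linarith⟩)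
  have hne : (tsupport θ ∪ {T / 2}).Nonempty := ⟨T / 2, Or.inr rfl⟩
  obtain ⟨a, haK, ha⟩ := hK.exists_isLeast hne
  obtain ⟨b, hbK, hb⟩ := hK.exists_isGreatest hne
  have hlt : ∀ t, t < a → θ t = 0 := fun t ht => by
    by_contra h
    exact not_le.2 ht (ha (Or.inl (subset_tsupport _ h)))
  have hgt : ∀ t, b < t → θ t = 0 := fun t ht => by
    by_contra h
    exact not_le.2 ht (hb (Or.inl (subset_tsupport _ h)))
  have hsupp : Function.support (fun t => ∫ s in (0 : ℝ)..t, θ s) ⊆ Icc a b := by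
    intro t ht
    by_contra hn
    refine ht ?_
    rw [mem_Icc, not_and_or, not_le, not_le] at hn
    rcases hn with hn | hn
    · refine intervalIntegral.integral_zero_ae (Filter.Eventually.of_forall fun s hs => hlt s ?_)
      exact hs.2.trans_lt (max_lt (hKI haK).1 hn)
    · have e1 : ∫ s in (0 : ℝ)..T, θ s = 0 := by
        rw [intervalIntegral.integral_of_le hT.le, integral_Ioc_eq_integral_Ioo, h0]
      have e2 : ∫ s in T..t, θ s = 0 := by
        refine intervalIntegral.integral_zero_ae (Filter.Eventually.of_forall fun s hs => hgt s ?_)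
        exact (lt_min (hKI hbK).2 hn).trans hs.1
      change ∫ s in (0 : ℝ)..t, θ s = 0
      rw [← intervalIntegral.integral_add_adjacent_intervals
        (h1.continuous.intervalIntegrable 0 T) (h1.continuous.intervalIntegrable T t), e1, e2,
        add_zero]
  refine ⟨fun t => ∫ s in (0 : ℝ)..t, θ s, ?_,
    HasCompactSupport.of_support_subset_isCompact isCompact_Icc hsupp,
    (closure_minimal hsupp isClosed_Icc).trans fun t ht =>
      ⟨(hKI haK).1.trans_le ht.1, ht.2.trans_lt (hKI hbK).2⟩, hder⟩
  rw [contDiff_infty_iff_deriv]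
  exact ⟨fun t => (hd t).differentiableAt, by rw [hder]; exact h1⟩

theorem ae_eq_zero_of_integral_smul [CompleteSpace E] {h : ℝ → E} (hh : IntegrableOn h (Ioo 0 T))
    (H : ∀ ψ : ℝ → ℝ, ContDiff ℝ ∞ ψ → HasCompactSupport ψ → tsupport ψ ⊆ Ioo 0 T →
      ∫ t in Ioo 0 T, ψ t • h t = 0) : ∀ᵐ t ∂volume.restrict (Ioo 0 T), h t = 0 := by
  refine (ae_restrict_iff' measurableSet_Ioo).2
    (isOpen_Ioo.ae_eq_zero_of_integral_contDiff_smul_eq_zero hh.locallyIntegrableOn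
      fun ψ h1 h2 h3 => ?_)
  rw [← H ψ h1 h2 h3, setIntegral_eq_integral_of_forall_compl_eq_zero fun t ht => by
    rw [image_eq_zero_of_notMem_tsupport fun h' => ht (h3 h'), zero_smul]]

/-- The du Bois-Reymond lemma. -/
theorem IsWeakTimeDeriv.exists_ae_eq_const [CompleteSpace E] {h : ℝ → E} (hT : 0 < T)
    (hh : IntegrableOn h (Ioo 0 T)) (H : IsWeakTimeDeriv T h 0) :
    ∃ c : E, ∀ᵐ t ∂volume.restrict (Ioo 0 T), h t = c := by
  let b : ContDiffBump (T / 2) := ⟨T / 8, T / 4, by positivity, by linarith⟩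
  let η : ℝ → ℝ := b.normed volume
  have hη1 : ContDiff ℝ ∞ η := b.contDiff_normed
  have hη2 : HasCompactSupport η := b.hasCompactSupport_normed
  have hη3 : tsupport η ⊆ Ioo 0 T := by
    have : tsupport η = Metric.closedBall (T / 2) (T / 4) := b.tsupport_normed_eq
    rw [this, Real.closedBall_eq_Icc]
    intro t ht
    exact ⟨by linarith [ht.1], by linarith [ht.2]⟩
  have hη4 : ∫ t in Ioo 0 T, η t = 1 := by
    rw [setIntegral_eq_integral_of_forall_compl_eq_zero fun t ht =>
      image_eq_zero_of_notMem_tsupport fun h' => ht (hη3 h')]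
    exact b.integral_normed
  refine ⟨∫ t in Ioo 0 T, η t • h t, ?_⟩
  have hz := ae_eq_zero_of_integral_smul (T := T) (h := fun t => h t - ∫ t in Ioo 0 T, η t • h t)
    (hh.sub (integrableOn_const (by simp))) ?_
  · filter_upwards [hz] with t ht using sub_eq_zero.1 ht
  intro χ hχ1 hχ2 hχ3
  let m : ℝ := ∫ t in Ioo 0 T, χ t
  -- As `η` has integral one, `χ - m η` has mean zero and so is the derivative of a test function.
  -- This lets `χ` be replaced by `m η`, which produces the constant `∫ η h`.
  obtain ⟨ψ, hψ1, hψ2, hψ3, hψ4⟩ := exists_contDiff_deriv_eq (θ := χ - m • η) hT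
    (hχ1.sub (hη1.const_smul m)) (hχ2.sub (hη2.smul_left (f := fun _ => m)))
    ((tsupport_sub _ _).trans (union_subset hχ3
      ((closure_mono (Function.support_const_smul_subset m η)).trans hη3)))
    (by
      simp only [Pi.sub_apply, Pi.smul_apply]
      rw [integral_sub (f := χ) (g := fun t => m • η t) hχ1.continuous.integrableOn_Ioo
        (hη1.continuous.const_smul m).integrableOn_Ioo, integral_smul, hη4]
      simp [m])
  have hw := H ψ hψ1 hψ2 hψ3
  have hmη : IntegrableOn (fun t => m • η t • h t) (Ioo 0 T) :=
    (hh.continuous_smul hη1.continuous).smul m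
  rw [hψ4] at hw
  simp only [Pi.sub_apply, Pi.smul_apply, sub_smul, Pi.zero_apply, smul_zero, integral_zero,
    neg_zero, smul_assoc] at hw
  rw [integral_sub (hh.continuous_smul hχ1.continuous) (hmη), integral_smul] at hw
  simp only [smul_sub]
  rw [integral_sub (hh.continuous_smul hχ1.continuous) 
    (hχ1.continuous.integrableOn_Ioo.smul_const _),
    integral_smul_const]
  exact hw

/-- The primitive of `w` also has weak derivative `w`, by Fubini on the triangle, so du Bois-Reymond
applies to the difference. -/
theorem IsWeakTimeDeriv.exists_ae_eq_primitive [CompleteSpace E] {h w : ℝ → E} (hT : 0 < T)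
    (hh : IntegrableOn h (Ioo 0 T)) (hw : IntegrableOn w (Ioo 0 T)) (H : IsWeakTimeDeriv T h w) :
    ∃ c : E, ∀ᵐ t ∂volume.restrict (Ioo 0 T), h t = c + ∫ s in Ioo 0 t, w s := by
  have hd : IsWeakTimeDeriv T (fun t => h t - ∫ s in Ioo 0 t, w s) 0 := by
    intro ψ h1 h2 h3
    have hψT : ψ T = 0 := image_eq_zero_of_notMem_tsupport fun h' => lt_irrefl _ (h3 h').2
    have hψc : Continuous (deriv ψ) := h1.continuous_deriv (by simp)
    have hψi : IntegrableOn (deriv ψ) (Ioo 0 T) := hψc.integrableOn_Ioo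
    have e1 := integral_bilin_primitive (ContinuousLinearMap.lsmul ℝ ℝ : ℝ →L[ℝ] E →L[ℝ] E).flip
      hw hψi
    have e2 := integrableOn_bilin_primitive
      (ContinuousLinearMap.lsmul ℝ ℝ : ℝ →L[ℝ] E →L[ℝ] E).flip hw hψi
    simp only [ContinuousLinearMap.flip_apply, ContinuousLinearMap.lsmul_apply] at e1 e2
    simp only [smul_sub, Pi.zero_apply, smul_zero, integral_zero, neg_zero]
    rw [integral_sub (hh.continuous_smul hψc) e2, e1, H ψ h1 h2 h3, sub_eq_zero, ← integral_neg]
    refine setIntegral_congr_fun measurableSet_Ioo fun s hs => ?_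
    change _ = (∫ t in Ioo s T, deriv ψ t) • w s
    rw [setIntegral_Ioo_deriv (fun t => (h1.differentiable (by simp) t).hasDerivAt) hψc hs.2.le,
      hψT, zero_sub, neg_smul]
  obtain ⟨c, hc⟩ := hd.exists_ae_eq_const hT (hh.sub (integrableOn_primitive_Ioo hw))
  exact ⟨c, by filter_upwards [hc] with t ht using sub_eq_iff_eq_add.1 ht⟩

theorem IsWeakTimeDeriv.ae_unique [CompleteSpace E] {h w w' : ℝ → E}
    (hw : IntegrableOn w (Ioo 0 T)) (hw' : IntegrableOn w' (Ioo 0 T))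
    (H : IsWeakTimeDeriv T h w) (H' : IsWeakTimeDeriv T h w') :
    ∀ᵐ t ∂volume.restrict (Ioo 0 T), w t = w' t := by
  have hz := ae_eq_zero_of_integral_smul (hw.sub hw') fun ψ h1 h2 h3 => by
    simp only [Pi.sub_apply, smul_sub]
    rw [integral_sub (hw.continuous_smul h1.continuous) (hw'.continuous_smul h1.continuous), sub_eq_zero,
      ← neg_inj, ← H ψ h1 h2 h3, H' ψ h1 h2 h3]
  filter_upwards [hz] with t ht using sub_eq_zero.1 ht

theorem eqOn_Icc_of_ae_eq {E : Type*} [NormedAddCommGroup E] {c c' : ℝ → E} (hT : 0 < T)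
    (hc : ContinuousOn c (Icc 0 T))
    (hc' : ContinuousOn c' (Icc 0 T)) (h : ∀ᵐ t ∂volume.restrict (Ioo 0 T), c t = c' t) :
    EqOn c c' (Icc 0 T) := by
  have h1 : EqOn c c' (Ioo 0 T) :=
    Measure.eqOn_open_of_ae_eq h isOpen_Ioo (hc.mono Ioo_subset_Icc_self)
      (hc'.mono Ioo_subset_Icc_self)
  rw [← closure_Ioo hT.ne] at hc hc' ⊢
  exact h1.of_subset_closure hc hc' subset_closure subset_rfl

end Time

/-! ### Abstract setting and test curves. -/

/-- The bilinear form `(L v, L w)` as an operator from a space to its dual. -/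
def pullbackForm {V K : Type*} [NormedAddCommGroup V] [NormedSpace ℝ V] [NormedAddCommGroup K]
    [InnerProductSpace ℝ K] (L : V →L[ℝ] K) : V →L[ℝ] StrongDual ℝ V :=
  (innerSL ℝ).bilinearComp L L

/-- The norm of `L v` in `L²(0, T; K)`. -/
def timeNorm {V K : Type*} [NormedAddCommGroup V] [NormedSpace ℝ V] [NormedAddCommGroup K]
    [NormedSpace ℝ K] (T : ℝ) (L : V →L[ℝ] K) (v : ℝ → V) : ℝ :=
  Real.sqrt (∫ t in Ioo 0 T, ‖L (v t)‖ ^ 2)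

/-- `φ` is a continuously differentiable curve with derivative `φ'` and `φ(T) = 0`. -/
structure IsTestCurve {V : Type*} [NormedAddCommGroup V] [NormedSpace ℝ V] (T : ℝ)
    (φ φ' : ℝ → V) : Prop where
  hasDerivAt : ∀ t, HasDerivAt φ (φ' t) t
  continuous_deriv : Continuous φ'
  final : φ T = 0

theorem _root_.Continuous.memL2Time {V : Type*} [NormedAddCommGroup V] {φ : ℝ → V}
    (h : Continuous φ) (T : ℝ) : MemL2Time T φ := by
  obtain ⟨C, hC⟩ := isCompact_Icc.exists_bound_of_continuousOn (h.continuousOn (s := Icc 0 T))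
  refine MemLp.of_bound (h.continuousOn.aestronglyMeasurable measurableSet_Ioo) C ?_
  filter_upwards [ae_restrict_mem measurableSet_Ioo] with t ht
  exact hC t (Ioo_subset_Icc_self ht)

theorem MemL2Time.integrableOn {V : Type*} [NormedAddCommGroup V] {T : ℝ} {v : ℝ → V}
    (h : MemL2Time T v) : IntegrableOn v (Ioo 0 T) :=
  MemLp.integrable (by norm_num) h

theorem MemL2Time.clm {V W : Type*} [NormedAddCommGroup V] [NormedSpace ℝ V]
    [NormedAddCommGroup W] [NormedSpace ℝ W] {T : ℝ} {v : ℝ → V} (h : MemL2Time T v)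
    (L : V →L[ℝ] W) : MemL2Time T fun t => L (v t) :=
  L.comp_memLp' h

namespace IsTestCurve

variable {V : Type*} [NormedAddCommGroup V] [NormedSpace ℝ V] {T : ℝ} {φ φ' ψ ψ' : ℝ → V}

theorem continuous (h : IsTestCurve T φ φ') : Continuous φ :=
  continuous_iff_continuousAt.2 fun t => (h.hasDerivAt t).continuousAt

theorem add (h : IsTestCurve T φ φ') (k : IsTestCurve T ψ ψ') :
    IsTestCurve T (φ + ψ) (φ' + ψ') :=
  ⟨fun t => (h.hasDerivAt t).add (k.hasDerivAt t), h.continuous_deriv.add k.continuous_deriv, by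
    simp [h.final, k.final]⟩

theorem smul (c : ℝ) (h : IsTestCurve T φ φ') : IsTestCurve T (c • φ) (c • φ') :=
  ⟨fun t => (h.hasDerivAt t).const_smul c, h.continuous_deriv.const_smul c, by simp [h.final]⟩

theorem integral_deriv [CompleteSpace V] (h : IsTestCurve T φ φ') {s : ℝ} (hs : s ≤ T) :
    ∫ t in Ioo s T, φ' t = - φ s := by
  rw [setIntegral_Ioo_deriv h.hasDerivAt h.continuous_deriv hs, h.final, zero_sub]

/-- Integration by parts against a test curve. -/
theorem integral_bilin [CompleteSpace V] {E : Type*} [NormedAddCommGroup E] [NormedSpace ℝ E]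
    [CompleteSpace E] (h : IsTestCurve T φ φ') (hT : 0 ≤ T) (L : E →L[ℝ] V →L[ℝ] ℝ) {c : E}
    {v w : ℝ → E} (hw : IntegrableOn w (Ioo 0 T))
    (hv : ∀ᵐ t ∂volume.restrict (Ioo 0 T), v t = c + ∫ s in Ioo 0 t, w s) :
    ∫ t in Ioo 0 T, L (v t) (φ' t) = - L c (φ 0) - ∫ t in Ioo 0 T, L (w t) (φ t) := by
  have hφ' : IntegrableOn φ' (Ioo 0 T) := h.continuous_deriv.integrableOn_Ioo
  have h1 : ∀ᵐ t ∂volume.restrict (Ioo 0 T),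
      L (v t) (φ' t) = L c (φ' t) + L (∫ s in Ioo 0 t, w s) (φ' t) := by
    filter_upwards [hv] with t ht
    rw [ht, map_add, add_apply]
  rw [integral_congr_ae h1, integral_add ((L c).integrable_comp hφ')
    (integrableOn_bilin_primitive L hw hφ'), (L c).integral_comp_comm hφ', h.integral_deriv hT,
    map_neg, integral_bilin_primitive L hw hφ', sub_eq_add_neg, ← integral_neg]
  congr 1
  refine setIntegral_congr_fun measurableSet_Ioo fun s hs => ?_
  change L (w s) (∫ t in Ioo s T, φ' t) = _
  rw [h.integral_deriv hs.2.le, map_neg]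

end IsTestCurve

/-- These curves have a freely chosen scalar derivative, and their value at `0` is not constrained.
Testing with them therefore also detects the initial value. -/
theorem isTestCurve_primitive_smul {V : Type*} [NormedAddCommGroup V] [NormedSpace ℝ V] (T : ℝ)
    {χ : ℝ → ℝ} (hχ : Continuous χ) (w : V) :
    IsTestCurve T (fun t => (-∫ s in T..t, χ s) • w) (fun t => (-χ t) • w) :=
  ⟨fun t => ((hχ.integral_hasStrictDerivAt T t).hasDerivAt.neg).smul_const w,
    hχ.neg.smul continuous_const, by simp⟩

/-! ### The backward operator `φ ↦ φ - R∂ₜφ`: isometry, dense range, inf-sup stability. -/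

section Spaces

variable {V H K : Type*} [NormedAddCommGroup V] [InnerProductSpace ℝ V]
  [NormedAddCommGroup H] [InnerProductSpace ℝ H] [NormedAddCommGroup K] [InnerProductSpace ℝ K] {T : ℝ}
  {j : V →L[ℝ] H} {D : V →L[ℝ] K}

theorem pullbackForm_apply (v w : V) : pullbackForm D v w = inner ℝ (D v) (D w) := rfl

theorem pullbackForm_comm (v w : V) : pullbackForm D v w = pullbackForm D w v :=
  real_inner_comm _ _

theorem integrableOn_inner {K : Type*} [NormedAddCommGroup K] [InnerProductSpace ℝ K]
    {a b : ℝ → K} (ha : MemLp a 2 (volume.restrict (Ioo 0 T)))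
    (hb : MemLp b 2 (volume.restrict (Ioo 0 T))) :
    IntegrableOn (fun t => inner ℝ (a t) (b t)) (Ioo 0 T) :=
  (L2.integrable_inner (𝕜 := ℝ) (ha.toLp a) (hb.toLp b)).congr <| by
    filter_upwards [ha.coeFn_toLp, hb.coeFn_toLp] with t h1 h2
    rw [h1, h2]

theorem timeNorm_eq_norm_toLp {v : ℝ → V} (hv : MemL2Time T v) :
    timeNorm T D v = ‖(hv.clm D).toLp (fun t => D (v t))‖ := by
  rw [timeNorm, ← Real.sqrt_sq (norm_nonneg (MemLp.toLp _ (hv.clm D))),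
    ← real_inner_self_eq_norm_sq, L2.inner_def]
  congr 1
  refine integral_congr_ae ?_
  filter_upwards [(hv.clm D).coeFn_toLp] with t ht
  rw [ht, real_inner_self_eq_norm_sq]

theorem abs_integral_inner_le {v w : ℝ → V} (hv : MemL2Time T v) (hw : MemL2Time T w) :
    |∫ t in Ioo 0 T, inner ℝ (D (v t)) (D (w t))| ≤ timeNorm T D v * timeNorm T D w := by
  rw [timeNorm_eq_norm_toLp hv, timeNorm_eq_norm_toLp hw]
  refine le_of_eq_of_le (congrArg _ ?_) (abs_real_inner_le_norm _ _)
  rw [L2.inner_def]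
  refine integral_congr_ae ?_
  filter_upwards [(hv.clm D).coeFn_toLp, (hw.clm D).coeFn_toLp] with t ht ht'
  rw [ht, ht']

theorem timeNorm_sq (v : ℝ → V) : timeNorm T D v ^ 2 = ∫ t in Ioo 0 T, ‖D (v t)‖ ^ 2 :=
  Real.sq_sqrt (integral_nonneg fun _ => sq_nonneg _)

variable {R : StrongDual ℝ V →L[ℝ] V}

theorem memL2Time_sub_riesz {φ φ' : ℝ → V} (h : IsTestCurve T φ φ') :
    MemL2Time T fun t => φ t - R (pullbackForm j (φ' t)) :=
  (h.continuous.sub (R.continuous.comp ((pullbackForm j).continuous.comp h.continuous_deriv))).memL2Time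
    T

/-- The energy identity for `φ - R ∂ₜφ`. -/
theorem timeNorm_sub_riesz_sq (hT : 0 ≤ T)
    (hR : ∀ (Φ : StrongDual ℝ V) (v : V), inner ℝ (D (R Φ)) (D v) = Φ v) {φ φ' : ℝ → V}
    (h : IsTestCurve T φ φ') :
    timeNorm T D (fun t => φ t - R (pullbackForm j (φ' t))) ^ 2 =
      (∫ t in Ioo 0 T, (‖D (R (pullbackForm j (φ' t)))‖ ^ 2 + ‖D (φ t)‖ ^ 2)) +
        ‖j (φ 0)‖ ^ 2 := by
  have hc := h.continuous
  have hc' := h.continuous_deriv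
  -- By the defining property of `R`, the cross term of the square is `-2 (jφ, jφ')`, minus the
  -- derivative of `‖jφ‖²`. It integrates to `‖jφ(0)‖²` since `φ(T) = 0`.
  have hder : ∀ t, HasDerivAt (fun t => ‖j (φ t)‖ ^ 2) (2 * inner ℝ (j (φ t)) (j (φ' t))) t :=
    fun t => (j.hasFDerivAt.comp_hasDerivAt t (h.hasDerivAt t)).norm_sq
  have hcd : Continuous fun t => 2 * inner ℝ (j (φ t)) (j (φ' t)) := by fun_prop
  have hn : Continuous fun t => ‖D (R (pullbackForm j (φ' t)))‖ ^ 2 + ‖D (φ t)‖ ^ 2 := by fun_prop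
  have e1 := setIntegral_Ioo_deriv hder hcd hT
  rw [h.final, map_zero, norm_zero] at e1
  have e2 : ‖j (φ 0)‖ ^ 2 = -∫ t in Ioo 0 T, 2 * inner ℝ (j (φ t)) (j (φ' t)) := by
    rw [e1]; ring
  rw [timeNorm_sq, e2, ← sub_eq_add_neg, ← integral_sub hn.integrableOn_Ioo hcd.integrableOn_Ioo]
  refine integral_congr_ae (Filter.Eventually.of_forall fun t => ?_)
  simp only
  rw [map_sub, norm_sub_sq_real, real_inner_comm, hR, pullbackForm_apply, real_inner_comm]
  ring

variable [CompleteSpace V] [CompleteSpace K]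

/-- Uniqueness for the very weak formulation of the heat equation. -/
theorem ae_eq_zero_of_forall_testCurve {v : ℝ → V} (hv : MemL2Time T v)
    (H : ∀ φ φ' : ℝ → V, IsTestCurve T φ φ' →
      ∫ t in Ioo 0 T, (inner ℝ (D (v t)) (D (φ t)) - pullbackForm j (v t) (φ' t)) = 0) :
    ∀ᵐ t ∂volume.restrict (Ioo 0 T), D (v t) = 0 := by
  have hA : IntegrableOn (fun t => pullbackForm D (v t)) (Ioo 0 T) :=
    (hv.clm (pullbackForm D)).integrableOn
  have hι : IntegrableOn (fun t => pullbackForm j (v t)) (Ioo 0 T) :=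
    (hv.clm (pullbackForm j)).integrableOn
  -- Testing with `φ(t) = (∫ₜᵀ χ) w` gives the equation integrated in time, with zero initial value.
  have h1 : ∀ᵐ t ∂volume.restrict (Ioo 0 T),
      pullbackForm j (v t) + ∫ s in Ioo 0 t, pullbackForm D (v s) = 0 := by
    refine ae_eq_zero_of_integral_smul (hι.add (integrableOn_primitive_Ioo hA))
      fun χ hχ1 hχ2 hχ3 => ?_
    have hχ := hχ1.continuous
    have e1 := integral_bilin_primitive
      (ContinuousLinearMap.lsmul ℝ ℝ : ℝ →L[ℝ] StrongDual ℝ V →L[ℝ] StrongDual ℝ V).flip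
      hA hχ.integrableOn_Ioo
    simp only [ContinuousLinearMap.flip_apply, ContinuousLinearMap.lsmul_apply] at e1
    have e2 : ∫ s in Ioo 0 T, (∫ t in Ioo s T, χ t) • pullbackForm D (v s) =
        ∫ s in Ioo 0 T, (-∫ t in T..s, χ t) • pullbackForm D (v s) := by
      refine setIntegral_congr_fun measurableSet_Ioo fun s hs => ?_
      rw [← intervalIntegral.integral_symm, intervalIntegral.integral_of_le hs.2.le,
        integral_Ioc_eq_integral_Ioo]
    have hk : Continuous fun s => -∫ t in T..s, χ t :=
      (isTestCurve_primitive_smul T hχ (1 : ℝ)).continuous.congr fun s => by simp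
    simp only [smul_add]
    rw [integral_add (hι.continuous_smul hχ)
      ((integrableOn_primitive_Ioo hA).continuous_smul hχ), e1, e2]
    ext w
    have e3 := H _ _ (isTestCurve_primitive_smul T hχ w)
    rw [add_apply, ContinuousLinearMap.integral_apply (hι.continuous_smul hχ),
      ContinuousLinearMap.integral_apply (hA.continuous_smul hk), ← integral_add
        ((hι.continuous_smul hχ).apply_continuousLinearMap w)
        ((hA.continuous_smul hk).apply_continuousLinearMap w)]
    refine Eq.trans (integral_congr_ae (Filter.Eventually.of_forall fun t => ?_)) e3
    simp only [smul_apply, pullbackForm_apply, map_smul, inner_smul_right,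
      smul_eq_mul]
    ring
  have hsq : IntegrableOn (fun t => ‖j (v t)‖ ^ 2) (Ioo 0 T) :=
    MemLp.integrable_norm_pow (hv.clm j) (by norm_num)
  -- Applying the integrated equation to `v(t)` gives `‖jv‖² = -(∫₀ᵗ Dv, Dv(t))`, whose time
  -- integral is nonpositive.
  have h2 : ∫ t in Ioo 0 T, ‖j (v t)‖ ^ 2 = 0 := by
    refine le_antisymm ?_ (integral_nonneg fun _ => sq_nonneg _)
    have e1 : ∫ t in Ioo 0 T, ‖j (v t)‖ ^ 2 =
        -∫ t in Ioo 0 T, inner ℝ (∫ s in Ioo 0 t, D (v s)) (D (v t)) := by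
      rw [← integral_neg]
      refine integral_congr_ae ?_
      filter_upwards [h1, ae_restrict_mem measurableSet_Ioo] with t ht htI
      have hvt : IntegrableOn v (Ioo 0 t) :=
        hv.integrableOn.mono_set (Ioo_subset_Ioo_right htI.2.le)
      rw [(pullbackForm D).integral_comp_comm hvt] at ht
      have h3 := congrArg (fun Φ : StrongDual ℝ V => Φ (v t)) ht
      simp only [add_apply, pullbackForm_apply,
        zero_apply, real_inner_self_eq_norm_sq] at h3
      rw [D.integral_comp_comm hvt]
      linarith
    rw [e1]
    linarith [integral_inner_primitive_nonneg (hv.clm D).integrableOn]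
  have h3 : ∀ᵐ t ∂volume.restrict (Ioo 0 T), j (v t) = 0 := by
    filter_upwards [(integral_eq_zero_iff_of_nonneg (fun _ => sq_nonneg _) hsq).1 h2] with t ht
    simpa using ht
  -- Once `jv = 0`, the term with `φ'` drops out and only the form of `D` remains. Injectivity of
  -- `j` is thus not needed.
  have h4 : ∀ᵐ t ∂volume.restrict (Ioo 0 T), pullbackForm D (v t) = 0 := by
    refine ae_eq_zero_of_integral_smul hA fun χ hχ1 hχ2 hχ3 => ?_
    ext w
    have hχT : χ T = 0 := image_eq_zero_of_notMem_tsupport fun h' => lt_irrefl _ (hχ3 h').2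
    have e3 := H (fun t => χ t • w) (fun t => deriv χ t • w)
      ⟨fun t => (hχ1.differentiable (by simp) t).hasDerivAt.smul_const w,
        (hχ1.continuous_deriv (by simp)).smul continuous_const, by simp [hχT]⟩
    rw [ContinuousLinearMap.integral_apply (hA.continuous_smul hχ1.continuous)]
    refine Eq.trans (integral_congr_ae ?_) e3
    filter_upwards [h3] with t ht
    simp [pullbackForm_apply, ht, inner_smul_right]
  filter_upwards [h4] with t ht
  have h5 := congrArg (fun Φ : StrongDual ℝ V => Φ (v t)) ht
  simpa [pullbackForm_apply] using h5


/-- The classes of the functions `φ - R ∂ₜφ`, where `φ` is a test curve. -/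
def adjointRange (T : ℝ) (j : V →L[ℝ] H) (R : StrongDual ℝ V →L[ℝ] V) :
    Submodule ℝ (Lp V 2 (volume.restrict (Ioo 0 T))) where
  carrier := {s | ∃ φ φ' : ℝ → V, IsTestCurve T φ φ' ∧
    s =ᵐ[volume.restrict (Ioo 0 T)] fun t => φ t - R (pullbackForm j (φ' t))}
  zero_mem' := by
    refine ⟨0, 0, ⟨fun t => hasDerivAt_const t 0, continuous_const, rfl⟩, ?_⟩
    filter_upwards [Lp.coeFn_zero V 2 (volume.restrict (Ioo 0 T))] with t ht
    rw [ht]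
    simp
  add_mem' := by
    rintro a b ⟨φ, φ', h, h1⟩ ⟨ψ, ψ', k, k1⟩
    refine ⟨φ + ψ, φ' + ψ', h.add k, ?_⟩
    filter_upwards [h1, k1, Lp.coeFn_add a b] with t ht kt hab
    simp only [hab, Pi.add_apply, ht, kt, map_add]
    abel
  smul_mem' := by
    rintro c a ⟨φ, φ', h, h1⟩
    refine ⟨c • φ, c • φ', h.smul c, ?_⟩
    filter_upwards [h1, Lp.coeFn_smul c a] with t ht hab
    simp only [hab, Pi.smul_apply, ht, map_smul, smul_sub]

/-- Orthogonality refers to the full inner product of `V`, not to the form of `D`. If `z` is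
orthogonal to the range, its functional `(z, ·)` is represented by `v = R(z, ·)`; by symmetry of
`R`, `v` satisfies the homogeneous very weak equation. Then `Dv = 0`, and `‖z‖² = (Dv, Dz) = 0`. -/
theorem adjointRange_dense
    (hR : ∀ (Φ : StrongDual ℝ V) (v : V), inner ℝ (D (R Φ)) (D v) = Φ v) :
    (adjointRange T j R).topologicalClosure = ⊤ := by
  rw [Submodule.topologicalClosure_eq_top_iff, Submodule.eq_bot_iff]
  intro z hz
  rw [Submodule.mem_orthogonal'] at hz
  have hzL : MemL2Time T z := Lp.memLp z
  have hv : MemL2Time T fun t => R (innerSL ℝ (z t)) := hzL.clm (R.comp (innerSL ℝ))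
  have h0 := ae_eq_zero_of_forall_testCurve (j := j) (D := D) hv fun φ φ' h => by
    have hm := memL2Time_sub_riesz (j := j) (R := R) h
    have h1 := hz (hm.toLp _) ⟨φ, φ', h, hm.coeFn_toLp⟩
    rw [L2.inner_def] at h1
    refine Eq.trans (integral_congr_ae ?_) h1
    filter_upwards [hm.coeFn_toLp] with t ht
    have e1 := hR (pullbackForm j (φ' t)) (R (innerSL ℝ (z t)))
    rw [real_inner_comm, hR, innerSL_apply_apply] at e1
    rw [ht, inner_sub_right, hR, innerSL_apply_apply, pullbackForm_comm, e1]
  rw [Lp.eq_zero_iff_ae_eq_zero]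
  filter_upwards [h0] with t ht
  have h1 := hR (innerSL ℝ (z t)) (z t)
  rw [ht, inner_zero_left, innerSL_apply_apply] at h1
  simpa using h1.symm

/-- The inf-sup stability of the heat equation, with constant one. -/
theorem timeNorm_le_of_forall_testCurve
    (hR : ∀ (Φ : StrongDual ℝ V) (v : V), inner ℝ (D (R Φ)) (D v) = Φ v)
    {e : ℝ → V} (he : MemL2Time T e) {M : ℝ} (hM : 0 ≤ M)
    (H : ∀ φ φ' : ℝ → V, IsTestCurve T φ φ' →
      ∫ t in Ioo 0 T, (inner ℝ (D (e t)) (D (φ t)) - pullbackForm j (e t) (φ' t)) ≤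
        M * timeNorm T D fun t => φ t - R (pullbackForm j (φ' t))) :
    timeNorm T D e ≤ M := by
  let DL : Lp V 2 (volume.restrict (Ioo 0 T)) →L[ℝ]
    Lp K 2 (volume.restrict (Ioo 0 T)) := D.compLpL 2 _
  have hD : ∀ {v : ℝ → V} (hv : MemL2Time T v)
      (x : Lp V 2 (volume.restrict (Ioo 0 T))), x =ᵐ[volume.restrict (Ioo 0 T)] v →
      DL x = (hv.clm D).toLp (fun t => D (v t)) := by
    intro v hv x hx
    refine Lp.ext ?_
    filter_upwards [D.coeFn_compLpL x, (hv.clm D).coeFn_toLp, hx] with t h1 h2 h3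
    rw [h1, h2, h3]
  -- The bound is a closed condition on `x = φ - R∂ₜφ`, so by density it holds at `x = e`, where it
  -- reads `‖De‖² ≤ M ‖De‖`.
  have hcl : IsClosed {x : Lp V 2 (volume.restrict (Ioo 0 T)) |
      inner ℝ (DL (he.toLp e)) (DL x) ≤ M * ‖DL x‖} :=
    isClosed_le (by fun_prop) (by fun_prop)
  have hmem : he.toLp e ∈ (adjointRange T j R).topologicalClosure := by
    rw [adjointRange_dense hR]; trivial
  have hle := closure_minimal (s := (adjointRange T j R : Set _)) (fun x hx => ?_) hcl hmem
  · change inner ℝ (DL (he.toLp e)) (DL (he.toLp e)) ≤ M * ‖DL (he.toLp e)‖ at hle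
    rw [real_inner_self_eq_norm_sq, hD he _ he.coeFn_toLp, ← timeNorm_eq_norm_toLp he, sq] at hle
    have h0 : 0 ≤ timeNorm T D e := Real.sqrt_nonneg _
    rcases h0.eq_or_lt with h | h
    · rw [← h]; exact hM
    · exact le_of_mul_le_mul_right hle h
  · obtain ⟨φ, φ', h, hx⟩ := hx
    have hm := memL2Time_sub_riesz (j := j) (R := R) h
    change inner ℝ (DL (he.toLp e)) (DL x) ≤ M * ‖DL x‖
    rw [hD he _ he.coeFn_toLp, hD hm _ hx, ← timeNorm_eq_norm_toLp hm]
    refine le_of_eq_of_le ?_ (H φ φ' h)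
    rw [L2.inner_def]
    refine integral_congr_ae ?_
    filter_upwards [(he.clm D).coeFn_toLp, (hm.clm D).coeFn_toLp] with t h1 h2
    rw [h1, h2, map_sub, inner_sub_right, real_inner_comm (D (R _)), hR, pullbackForm_comm]

end Spaces

/-! ### Dual pairings in time and the time-integrated weak formulation. -/

theorem isWeakTimeDeriv_of_hasDerivAt {E : Type*} [NormedAddCommGroup E] [NormedSpace ℝ E]
    [CompleteSpace E] {T : ℝ} (hT : 0 ≤ T) {v v' : ℝ → E} (h : ∀ t, HasDerivAt v (v' t) t)
    (hc : Continuous v') : IsWeakTimeDeriv T v v' := by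
  intro ψ h1 h2 h3
  have hψ : ∀ t ∉ Ioo 0 T, ψ t = 0 := fun t ht =>
    image_eq_zero_of_notMem_tsupport fun h' => ht (h3 h')
  have hv : Continuous v := continuous_iff_continuousAt.2 fun t => (h t).continuousAt
  have hd : ∀ t, HasDerivAt (fun t => ψ t • v t) (ψ t • v' t + deriv ψ t • v t) t := fun t =>
    (h1.differentiable (by simp) t).hasDerivAt.smul (h t)
  have c1 : Continuous fun t => ψ t • v' t := h1.continuous.smul hc
  have c2 : Continuous fun t => deriv ψ t • v t := (h1.continuous_deriv (by simp)).smul hv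
  have e1 := setIntegral_Ioo_deriv hd (c1.add c2) hT
  rw [integral_add c1.integrableOn_Ioo c2.integrableOn_Ioo, hψ T fun h => lt_irrefl _ h.2,
    hψ 0 fun h => lt_irrefl _ h.1, zero_smul, zero_smul, sub_zero] at e1
  exact eq_neg_of_add_eq_zero_right e1

section Dual

variable {V H K : Type*} [NormedAddCommGroup V] [InnerProductSpace ℝ V]
  [NormedAddCommGroup H] [InnerProductSpace ℝ H] [NormedAddCommGroup K] [InnerProductSpace ℝ K]
  {T : ℝ} {j : V →L[ℝ] H} {D : V →L[ℝ] K} {R : StrongDual ℝ V →L[ℝ] V}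

/-- Through `R` the pairing becomes an `L²` inner product in `K`; the Cauchy-Schwarz bound below
uses the same rewriting. -/
theorem integrableOn_dual (hR : ∀ (Φ : StrongDual ℝ V) (v : V), inner ℝ (D (R Φ)) (D v) = Φ v)
    {F : ℝ → StrongDual ℝ V} {φ : ℝ → V} (hF : MemL2Time T F) (hφ : MemL2Time T φ) :
    IntegrableOn (fun t => F t (φ t)) (Ioo 0 T) := by
  simp_rw [← hR]
  exact integrableOn_inner ((hF.clm R).clm D) (hφ.clm D)

theorem abs_integral_dual_le
    (hR : ∀ (Φ : StrongDual ℝ V) (v : V), inner ℝ (D (R Φ)) (D v) = Φ v)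
    {F : ℝ → StrongDual ℝ V} {φ : ℝ → V} (hF : MemL2Time T F) (hφ : MemL2Time T φ) :
    |∫ t in Ioo 0 T, F t (φ t)| ≤ timeNorm T D (fun t => R (F t)) * timeNorm T D φ := by
  simp_rw [← hR]
  exact abs_integral_inner_le (hF.clm R) hφ

theorem integrableOn_norm_sq {v : ℝ → V} (hv : MemL2Time T v) :
    IntegrableOn (fun t => ‖D (v t)‖ ^ 2) (Ioo 0 T) :=
  MemLp.integrable_norm_pow (hv.clm D) (by norm_num)

theorem integrableOn_dualNorm_sq {n : StrongDual ℝ V → ℝ} (hn : ∀ Φ, n Φ = ‖D (R Φ)‖)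
    {w : ℝ → StrongDual ℝ V} (hw : MemL2Time T w) :
    IntegrableOn (fun t => n (w t) ^ 2) (Ioo 0 T) := by
  simp_rw [hn]
  exact integrableOn_norm_sq (hw.clm R)

theorem IsTestCurve.isWeakTimeDeriv_pullbackForm {φ φ' : ℝ → V} (h : IsTestCurve T φ φ')
    (hT : 0 ≤ T) : IsWeakTimeDeriv T (fun t => pullbackForm j (φ t))
      fun t => pullbackForm j (φ' t) :=
  isWeakTimeDeriv_of_hasDerivAt hT
    (fun t => (pullbackForm j).hasFDerivAt.comp_hasDerivAt t (h.hasDerivAt t))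
    ((pullbackForm j).continuous.comp h.continuous_deriv)

/-- The time derivative and the initial value determine a function. -/
theorem pullbackForm_ae_eq_primitive (hT : 0 < T) {u : ℝ → V} {w : ℝ → StrongDual ℝ V}
    (hu : MemL2Time T u) (hw : MemL2Time T w)
    (huw : IsWeakTimeDeriv T (fun t => pullbackForm j (u t)) w) {c : ℝ → H}
    (hc : ContinuousOn c (Icc 0 T)) (hcu : ∀ᵐ t ∂volume.restrict (Ioo 0 T), c t = j (u t))
    {u₀ : V} (hc0 : c 0 = j u₀) :
    ∀ᵐ t ∂volume.restrict (Ioo 0 T),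
      pullbackForm j (u t) = pullbackForm j u₀ + ∫ s in Ioo 0 t, w s := by
  have hι : MemL2Time T fun t => pullbackForm j (u t) := hu.clm (pullbackForm j)
  obtain ⟨g, hg⟩ := huw.exists_ae_eq_primitive hT hι.integrableOn hw.integrableOn
  have hl : Continuous fun y : H => (innerSL ℝ y).comp j := by fun_prop
  -- Both sides are continuous representatives on `[0, T]`; comparing them at `0` identifies the
  -- constant of integration.
  have e := eqOn_Icc_of_ae_eq (c := fun t => (innerSL ℝ (c t)).comp j)
    (c' := fun t => g + ∫ s in Ioo 0 t, w s) hT (hl.comp_continuousOn hc)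
    (continuousOn_const.add (continuousOn_primitive_Ioo hw.integrableOn)) (by
      filter_upwards [hg, hcu] with t h1 h2
      rw [h2, ← h1]; rfl) ⟨le_rfl, hT.le⟩
  simp only [Ioo_self, Measure.restrict_empty, integral_zero_measure, add_zero, hc0] at e
  have hg0 : g = pullbackForm j u₀ := e.symm
  rwa [hg0] at hg

variable [CompleteSpace V]

/-- The weak formulation of the heat equation after integration by parts in time, for a solution
whose values are primitives of its time derivative. -/
theorem integral_testCurve_eq (hT : 0 ≤ T)
    (hR : ∀ (Φ : StrongDual ℝ V) (v : V), inner ℝ (D (R Φ)) (D v) = Φ v)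
    {u p : ℝ → V} {w f : ℝ → StrongDual ℝ V} {g : StrongDual ℝ V} (hu : MemL2Time T u)
    (hp : MemL2Time T p) (hw : MemL2Time T w) (hf : MemL2Time T f)
    (hg : ∀ᵐ t ∂volume.restrict (Ioo 0 T), pullbackForm j (u t) = g + ∫ s in Ioo 0 t, w s)
    (heq : ∀ᵐ t ∂volume.restrict (Ioo 0 T), ∀ v, w t v + inner ℝ (D (p t)) (D v) = f t v)
    {φ φ' : ℝ → V} (h : IsTestCurve T φ φ') :
    ∫ t in Ioo 0 T, (inner ℝ (D (p t)) (D (φ t)) - pullbackForm j (u t) (φ' t)) =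
      (∫ t in Ioo 0 T, f t (φ t)) + g (φ 0) := by
  have e1 := h.integral_bilin hT (ContinuousLinearMap.id ℝ (StrongDual ℝ V))
    (v := fun t => pullbackForm j (u t)) hw.integrableOn hg
  simp only [ContinuousLinearMap.coe_id', id_eq] at e1
  have hφ : MemL2Time T φ := h.continuous.memL2Time T
  have i1 : IntegrableOn (fun t => inner ℝ (D (p t)) (D (φ t))) (Ioo 0 T) :=
    integrableOn_inner (hp.clm D) (hφ.clm D)
  have i2 : IntegrableOn (fun t => pullbackForm j (u t) (φ' t)) (Ioo 0 T) :=
    integrableOn_inner (hu.clm j) ((h.continuous_deriv.memL2Time T).clm j)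
  have e2 : ∫ t in Ioo 0 T, w t (φ t) =
      ∫ t in Ioo 0 T, (f t (φ t) - inner ℝ (D (p t)) (D (φ t))) := by
    refine integral_congr_ae ?_
    filter_upwards [heq] with t ht
    rw [← ht (φ t), add_sub_cancel_right]
  rw [integral_sub i1 i2, e1, e2, integral_sub (integrableOn_dual hR hf hφ) i1]
  ring

end Dual

/-! ### The space `Y_T`, its norm and its dual quotients. -/

theorem HasTimeValue.unique {d : ℕ} {Ω : Set (Euc d)} {T : ℝ} (hT : 0 < T) {φ : ℝ → H10 Ω}
    {s : ℝ} (hs : s ∈ Icc 0 T) {g g' : L2 Ω} (h : HasTimeValue T φ s g)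
    (h' : HasTimeValue T φ s g') : g = g' := by
  obtain ⟨c, hc, hcφ, rfl⟩ := h
  obtain ⟨c', hc', hcφ', rfl⟩ := h'
  refine eqOn_Icc_of_ae_eq hT hc hc' ?_ hs
  filter_upwards [hcφ, hcφ'] with t h1 h2 using h1.trans h2.symm

theorem MemY.hasTimeDeriv {d : ℕ} {Ω : Set (Euc d)} {T : ℝ} {φ : ℝ → H10 Ω} (h : MemY T φ) :
    HasTimeDeriv T φ (timeDeriv T φ) := by
  rw [timeDeriv, dif_pos h.2]
  exact h.2.choose_spec

namespace IsTestCurve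

variable {d : ℕ} {Ω : Set (Euc d)} {T : ℝ} {φ φ' : ℝ → H10 Ω}

/-- `pullbackForm toL2 v` and `l2ToDual (toL2 v)` agree by definition, which connects the abstract
setting to `HasTimeDeriv`. -/
theorem hasTimeDeriv (h : IsTestCurve T φ φ') (hT : 0 ≤ T) :
    HasTimeDeriv T φ fun t => pullbackForm toL2 (φ' t) :=
  ⟨((pullbackForm toL2).continuous.comp h.continuous_deriv).memL2Time T,
    h.isWeakTimeDeriv_pullbackForm (j := toL2) hT⟩

theorem memY (h : IsTestCurve T φ φ') (hT : 0 ≤ T) : MemY T φ :=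
  ⟨h.continuous.memL2Time T, _, h.hasTimeDeriv hT⟩

theorem hasTimeValue (h : IsTestCurve T φ φ') (s : ℝ) : HasTimeValue T φ s (toL2 (φ s)) :=
  ⟨fun t => toL2 (φ t), (toL2.continuous.comp h.continuous).continuousOn,
    Filter.Eventually.of_forall fun _ => rfl, rfl⟩

theorem memYT (h : IsTestCurve T φ φ') (hT : 0 ≤ T) : MemYT T φ :=
  ⟨h.memY hT, by simpa [h.final] using h.hasTimeValue T⟩

theorem timeDeriv_ae_eq (h : IsTestCurve T φ φ') (hT : 0 ≤ T) :
    ∀ᵐ t ∂volume.restrict (Ioo 0 T), timeDeriv T φ t = pullbackForm toL2 (φ' t) :=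
  (h.memY hT).hasTimeDeriv.2.ae_unique (h.memY hT).hasTimeDeriv.1.integrableOn
    (h.hasTimeDeriv hT).1.integrableOn (h.hasTimeDeriv hT).2

theorem timeValue_zero (h : IsTestCurve T φ φ') (hT : 0 < T) : timeValue T φ 0 = toL2 (φ 0) := by
  have hex : ∃ g, HasTimeValue T φ 0 g := ⟨_, h.hasTimeValue 0⟩
  rw [timeValue, dif_pos hex]
  exact hex.choose_spec.unique hT ⟨le_rfl, hT.le⟩ (h.hasTimeValue 0)

end IsTestCurve

/-- One of the curves `±(t - T) w` has a nonnegative quotient. If `H¹₀(Ω)` is trivial, the set is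
empty and its supremum is `0`. -/
theorem sSup_dualQuotientsYT_nonneg {d : ℕ} {Ω : Set (Euc d)} {T : ℝ} (hT : 0 < T)
    (F : ℝ → Hm1 Ω) : 0 ≤ sSup (dualQuotientsYT T F) := by
  by_cases hV : ∃ w : H10 Ω, w ≠ 0
  · obtain ⟨w, hw⟩ := hV
    have key : ∀ c : ℝ, c ≠ 0 → 0 ≤ ∫ t in Ioo 0 T, F t ((c * (t - T)) • w) →
        0 ≤ sSup (dualQuotientsYT T F) := by
      intro c hc h0
      have htc : IsTestCurve T (fun t => (c * (t - T)) • w) (fun _ => (c * 1) • w) :=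
        ⟨fun t => (((hasDerivAt_id t).sub_const T).const_mul c).smul_const w, continuous_const,
          by simp⟩
      refine Real.sSup_nonneg' ⟨_, ⟨_, htc.memYT hT.le, fun hz => ?_, rfl⟩,
        div_nonneg h0 (Real.sqrt_nonneg _)⟩
      have hpos : (volume.restrict (Ioo 0 T)) ≠ 0 := by
        simp [Measure.restrict_eq_zero, hT]
      have : (ae (volume.restrict (Ioo 0 T))).NeBot := ae_neBot.2 hpos
      obtain ⟨t, ht, htI⟩ := (hz.and (ae_restrict_mem measurableSet_Ioo)).exists
      simp only [Pi.zero_apply, smul_eq_zero, mul_eq_zero, hw, hc, or_false, false_or,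
        sub_eq_zero] at ht
      exact htI.2.ne ht
    rcases le_total 0 (∫ t in Ioo 0 T, F t (((1 : ℝ) * (t - T)) • w)) with h | h
    · exact key 1 one_ne_zero h
    · refine key (-1) (by norm_num) ?_
      have : ∫ t in Ioo 0 T, F t (((-1 : ℝ) * (t - T)) • w) =
          -∫ t in Ioo 0 T, F t (((1 : ℝ) * (t - T)) • w) := by
        rw [← integral_neg]
        refine integral_congr_ae (Filter.Eventually.of_forall fun t => ?_)
        simp only [map_smul, smul_eq_mul]
        ring
      rw [this]
      linarith
  · push Not at hV
    have : dualQuotientsYT T F = ∅ := by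
      refine eq_empty_of_forall_notMem ?_
      rintro _ ⟨φ, -, hz, -⟩
      exact hz (Filter.Eventually.of_forall fun t => hV _)
    rw [this, Real.sSup_empty]

section Riesz

variable {d : ℕ} {Ω : Set (Euc d)} {T : ℝ} {R : Hm1 Ω →L[ℝ] H10 Ω}

/-- This is the energy identity. The chosen `timeDeriv` and `timeValue` are matched with the
classical ones by uniqueness. -/
theorem IsTestCurve.normYT_eq (hT : 0 < T)
    (hR : ∀ (Φ : Hm1 Ω) (v : H10 Ω), inner ℝ (grad (R Φ)) (grad v) = Φ v)
    (hn : ∀ Φ : Hm1 Ω, dualNorm Φ = ‖grad (R Φ)‖) {φ φ' : ℝ → H10 Ω} (h : IsTestCurve T φ φ') :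
    normYT T φ = timeNorm T grad fun t => φ t - R (pullbackForm toL2 (φ' t)) := by
  have h0 : 0 ≤ timeNorm T grad fun t => φ t - R (pullbackForm toL2 (φ' t)) := Real.sqrt_nonneg _
  rw [← Real.sqrt_sq h0, timeNorm_sub_riesz_sq hT.le hR h, normYT, h.timeValue_zero hT]
  congr 2
  refine integral_congr_ae ?_
  filter_upwards [h.timeDeriv_ae_eq hT.le] with t ht
  rw [hn, ht]

theorem normYT_sq (φ : ℝ → H10 Ω) : normYT T φ ^ 2 =
    (∫ t in Ioo 0 T, (dualNorm (timeDeriv T φ t) ^ 2 + ‖grad (φ t)‖ ^ 2))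
      + ‖timeValue T φ 0‖ ^ 2 :=
  Real.sq_sqrt (add_nonneg (integral_nonneg fun _ => by positivity) (sq_nonneg _))

theorem MemY.normYT_sq_eq (hn : ∀ Φ : Hm1 Ω, dualNorm Φ = ‖grad (R Φ)‖) {φ : ℝ → H10 Ω}
    (h : MemY T φ) : normYT T φ ^ 2 =
      timeNorm T grad (fun t => R (timeDeriv T φ t)) ^ 2 + timeNorm T grad φ ^ 2
        + ‖timeValue T φ 0‖ ^ 2 := by
  rw [normYT_sq, integral_add (integrableOn_dualNorm_sq hn h.hasTimeDeriv.1)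
    (integrableOn_norm_sq h.1), timeNorm_sq, timeNorm_sq]
  simp_rw [hn]

theorem MemY.timeNorm_le_normYT (hn : ∀ Φ : Hm1 Ω, dualNorm Φ = ‖grad (R Φ)‖) {φ : ℝ → H10 Ω}
    (h : MemY T φ) : timeNorm T grad φ ≤ normYT T φ := by
  refine le_of_sq_le_sq ?_ (Real.sqrt_nonneg _)
  rw [h.normYT_sq_eq hn]
  nlinarith [sq_nonneg (timeNorm T grad (fun t => R (timeDeriv T φ t))),
    sq_nonneg ‖timeValue T φ 0‖]

theorem MemY.abs_integral_dual_le
    (hR : ∀ (Φ : Hm1 Ω) (v : H10 Ω), inner ℝ (grad (R Φ)) (grad v) = Φ v)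
    (hn : ∀ Φ : Hm1 Ω, dualNorm Φ = ‖grad (R Φ)‖) {F : ℝ → Hm1 Ω} (hF : MemL2Time T F)
    {φ : ℝ → H10 Ω} (h : MemY T φ) :
    |∫ t in Ioo 0 T, F t (φ t)| ≤ timeNorm T grad (fun t => R (F t)) * normYT T φ :=
  (ParabolicHeat.abs_integral_dual_le hR hF h.1).trans
    (mul_le_mul_of_nonneg_left (h.timeNorm_le_normYT hn) (Real.sqrt_nonneg _))

/-- Cauchy-Schwarz and `‖φ‖_X ≤ ‖φ‖_{Y_T}` bound every quotient by the `L²(0,T;H⁻¹)` norm of `F`. -/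
theorem bddAbove_dualQuotientsYT
    (hR : ∀ (Φ : Hm1 Ω) (v : H10 Ω), inner ℝ (grad (R Φ)) (grad v) = Φ v)
    (hn : ∀ Φ : Hm1 Ω, dualNorm Φ = ‖grad (R Φ)‖) {F : ℝ → Hm1 Ω} (hF : MemL2Time T F) :
    BddAbove (dualQuotientsYT T F) := by
  refine ⟨timeNorm T grad fun t => R (F t), ?_⟩
  rintro _ ⟨φ, hφ, -, rfl⟩
  exact div_le_of_le_mul₀ (Real.sqrt_nonneg _) (Real.sqrt_nonneg _)
    ((le_abs_self _).trans (hφ.1.abs_integral_dual_le hR hn hF))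

theorem MemYT.integral_dual_le_sSup (hT : 0 < T)
    (hR : ∀ (Φ : Hm1 Ω) (v : H10 Ω), inner ℝ (grad (R Φ)) (grad v) = Φ v)
    (hn : ∀ Φ : Hm1 Ω, dualNorm Φ = ‖grad (R Φ)‖) {F : ℝ → Hm1 Ω} (hF : MemL2Time T F)
    {φ : ℝ → H10 Ω} (h : MemYT T φ) :
    ∫ t in Ioo 0 T, F t (φ t) ≤ sSup (dualQuotientsYT T F) * normYT T φ := by
  have hY : 0 ≤ normYT T φ := Real.sqrt_nonneg _
  have hle := h.1.abs_integral_dual_le hR hn hF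
  rcases hY.eq_or_lt with h0 | h0
  · rw [← h0, mul_zero] at hle ⊢
    exact (le_abs_self _).trans hle
  · by_cases hz : φ =ᵐ[volume.restrict (Ioo 0 T)] 0
    · refine le_of_eq_of_le ?_ (mul_nonneg (sSup_dualQuotientsYT_nonneg hT F) hY)
      refine integral_eq_zero_of_ae ?_
      filter_upwards [hz] with t ht
      simp [ht]
    · exact (div_le_iff₀ h0).1 (le_csSup (bddAbove_dualQuotientsYT hR hn hF) ⟨φ, h, hz, rfl⟩)

end Riesz

/-- The weak formulation of the heat equation after integration by parts in time. -/
theorem IsWeakSolution.integral_testCurve {d : ℕ} {Ω : Set (Euc d)} {T : ℝ} (hT : 0 < T)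
    {R : Hm1 Ω →L[ℝ] H10 Ω}
    (hR : ∀ (Φ : Hm1 Ω) (v : H10 Ω), inner ℝ (grad (R Φ)) (grad v) = Φ v)
    {f : ℝ → Hm1 Ω} (hf : MemL2Time T f) {u₀ : H10 Ω} {u : ℝ → H10 Ω}
    (hu : IsWeakSolution T f (toL2 u₀) u) {φ φ' : ℝ → H10 Ω} (h : IsTestCurve T φ φ') :
    ∫ t in Ioo 0 T, (inner ℝ (grad (u t)) (grad (φ t)) - pullbackForm toL2 (u t) (φ' t)) =
      (∫ t in Ioo 0 T, f t (φ t)) + pullbackForm toL2 u₀ (φ 0) := by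
  obtain ⟨hY, heq, c, hc, hcu, hc0⟩ := hu
  exact integral_testCurve_eq hT.le hR hY.1 hY.1 hY.hasTimeDeriv.1 hf
    (pullbackForm_ae_eq_primitive (j := toL2) hT hY.1 hY.hasTimeDeriv.1 hY.hasTimeDeriv.2 hc hcu hc0) heq h

/-! ### Stability under a residual and a perturbation. -/

section Stability

variable {V H K : Type*} [NormedAddCommGroup V] [InnerProductSpace ℝ V]
  [NormedAddCommGroup H] [InnerProductSpace ℝ H] [NormedAddCommGroup K] [InnerProductSpace ℝ K]
  {T : ℝ} {j : V →L[ℝ] H} {D : V →L[ℝ] K} {R : StrongDual ℝ V →L[ℝ] V}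

/-- Both squared norms are summands in the energy identity. -/
theorem IsTestCurve.timeNorm_le (hT : 0 ≤ T)
    (hR : ∀ (Φ : StrongDual ℝ V) (v : V), inner ℝ (D (R Φ)) (D v) = Φ v) {φ φ' : ℝ → V}
    (h : IsTestCurve T φ φ') :
    timeNorm T D φ ≤ timeNorm T D (fun t => φ t - R (pullbackForm j (φ' t))) ∧
      timeNorm T D (fun t => R (pullbackForm j (φ' t))) ≤
        timeNorm T D (fun t => φ t - R (pullbackForm j (φ' t))) := by
  have hr : MemL2Time T fun t => R (pullbackForm j (φ' t)) :=
    (h.continuous_deriv.memL2Time T).clm (R.comp (pullbackForm j))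
  have e := timeNorm_sub_riesz_sq hT hR (j := j) h
  rw [integral_add (integrableOn_norm_sq hr) (integrableOn_norm_sq (h.continuous.memL2Time T)),
    ← timeNorm_sq, ← timeNorm_sq] at e
  constructor <;> refine le_of_sq_le_sq ?_ (Real.sqrt_nonneg _) <;> rw [e] <;>
    nlinarith [sq_nonneg (timeNorm T D φ), sq_nonneg ‖j (φ 0)‖,
      sq_nonneg (timeNorm T D (fun t => R (pullbackForm j (φ' t))))]

variable [CompleteSpace V] [CompleteSpace K]

/-- Stability of the heat equation with respect to a residual `M` and a perturbation `p - q` of the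
spatial part of the equation. -/
theorem timeNorm_sub_le_of_residual_le (hT : 0 ≤ T)
    (hR : ∀ (Φ : StrongDual ℝ V) (v : V), inner ℝ (D (R Φ)) (D v) = Φ v)
    {u p q : ℝ → V} (hu : MemL2Time T u) (hp : MemL2Time T p) (hq : MemL2Time T q)
    {M : ℝ} (hM : 0 ≤ M)
    (hres : ∀ φ φ' : ℝ → V, IsTestCurve T φ φ' →
      (∫ t in Ioo 0 T, (inner ℝ (D (u t)) (D (φ t)) - pullbackForm j (u t) (φ' t))) -
        ∫ t in Ioo 0 T, (inner ℝ (D (p t)) (D (φ t)) - pullbackForm j (q t) (φ' t)) ≤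
      M * timeNorm T D fun t => φ t - R (pullbackForm j (φ' t))) :
    timeNorm T D (fun t => u t - p t) ≤ timeNorm T D (fun t => p t - q t) + M ∧
      timeNorm T D (fun t => u t - q t) ≤ timeNorm T D (fun t => p t - q t) + M := by
  have hpq : MemL2Time T fun t => p t - q t := MemLp.sub hp hq
  have hJ : 0 ≤ timeNorm T D (fun t => p t - q t) := Real.sqrt_nonneg _
  have iD : ∀ {a φ : ℝ → V}, MemL2Time T a → MemL2Time T φ →
      IntegrableOn (fun t => inner ℝ (D (a t)) (D (φ t))) (Ioo 0 T) := fun ha hφ =>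
    integrableOn_inner (ha.clm D) (hφ.clm D)
  have iB : ∀ {a b φ φ' : ℝ → V}, MemL2Time T a → MemL2Time T b → MemL2Time T φ →
      MemL2Time T φ' → IntegrableOn (fun t => inner ℝ (D (a t)) (D (φ t)) -
        pullbackForm j (b t) (φ' t)) (Ioo 0 T) := fun ha hb hφ hφ' =>
    (iD ha hφ).sub (integrableOn_inner (hb.clm j) (hφ'.clm j))
  constructor
  · refine timeNorm_le_of_forall_testCurve (j := j) hR (hu.sub hp) (add_nonneg hJ hM) fun φ φ' h => ?_
    have hφ : MemL2Time T φ := h.continuous.memL2Time T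
    have hφ' : MemL2Time T φ' := h.continuous_deriv.memL2Time T
    have hr : MemL2Time T fun t => R (pullbackForm j (φ' t)) := hφ'.clm (R.comp (pullbackForm j))
    have hux : MemL2Time T fun t => u t - p t := MemLp.sub hu hp
    -- Besides the residual there remains `∫ (j(p - q), jφ')`, which `R` rewrites in terms of `D` so
    -- that `‖D(p - q)‖` controls it.
    have e : (∫ t in Ioo 0 T, (inner ℝ (D (u t - p t)) (D (φ t)) -
        pullbackForm j (u t - p t) (φ' t))) +
          ∫ t in Ioo 0 T, (inner ℝ (D (p t)) (D (φ t)) - pullbackForm j (q t) (φ' t)) =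
        (∫ t in Ioo 0 T, (inner ℝ (D (u t)) (D (φ t)) - pullbackForm j (u t) (φ' t))) +
        ∫ t in Ioo 0 T, inner ℝ (D (p t - q t)) (D (R (pullbackForm j (φ' t)))) := by
      rw [← integral_add (iB hux hux hφ hφ') (iB hp hq hφ hφ'),
        ← integral_add (iB hu hu hφ hφ') (iD hpq hr)]
      refine integral_congr_ae (Filter.Eventually.of_forall fun t => ?_)
      simp only
      rw [real_inner_comm (D (R _)), hR, pullbackForm_comm (φ' t)]
      simp only [map_sub, inner_sub_left, sub_apply]
      ring
    have h1 := hres φ φ' h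
    have h2 := (le_abs_self _).trans (abs_integral_inner_le (D := D) hpq hr)
    have h3 := mul_le_mul_of_nonneg_left (h.timeNorm_le (j := j) hT hR).2 hJ
    refine (eq_sub_of_add_eq e).trans_le ?_
    linarith
  · refine timeNorm_le_of_forall_testCurve (j := j) hR (hu.sub hq) (add_nonneg hJ hM) fun φ φ' h => ?_
    have hφ : MemL2Time T φ := h.continuous.memL2Time T
    have hφ' : MemL2Time T φ' := h.continuous_deriv.memL2Time T
    have hux : MemL2Time T fun t => u t - q t := MemLp.sub hu hq
    -- Now the mismatch sits in the spatial term and is paired with `Dφ` directly.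
    have e : (∫ t in Ioo 0 T, (inner ℝ (D (u t - q t)) (D (φ t)) -
        pullbackForm j (u t - q t) (φ' t))) +
          ∫ t in Ioo 0 T, (inner ℝ (D (p t)) (D (φ t)) - pullbackForm j (q t) (φ' t)) =
        (∫ t in Ioo 0 T, (inner ℝ (D (u t)) (D (φ t)) - pullbackForm j (u t) (φ' t))) +
        ∫ t in Ioo 0 T, inner ℝ (D (p t - q t)) (D (φ t)) := by
      rw [← integral_add (iB hux hux hφ hφ') (iB hp hq hφ hφ'),
        ← integral_add (iB hu hu hφ hφ') (iD hpq hφ)]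
      refine integral_congr_ae (Filter.Eventually.of_forall fun t => ?_)
      simp only [map_sub, inner_sub_left, sub_apply]
      ring
    have h1 := hres φ φ' h
    have h2 := (le_abs_self _).trans (abs_integral_inner_le (D := D) hpq hφ)
    have h3 := mul_le_mul_of_nonneg_left (h.timeNorm_le (j := j) hT hR).1 hJ
    refine (eq_sub_of_add_eq e).trans_le ?_
    linarith

end Stability

/-! ### Reconstructions of the implicit Euler method. -/

namespace TimeGrid

variable {T : ℝ} {N : ℕ} (G : TimeGrid T N)

theorem memL2Time_glue {E : Type*} [NormedAddCommGroup E] (g₀ : E) {g : Fin N → ℝ → E}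
    (hg : ∀ n, Continuous (g n)) : MemL2Time T (G.glue g₀ g) := by
  have h1 : MemL2Time T (({0} : Set ℝ).indicator fun _ => g₀) :=
    (memLp_const g₀).indicator (measurableSet_singleton 0)
  have h2 : MemL2Time T fun s =>
      ∑ n, (Ioc (G.pt n.castSucc) (G.pt n.succ)).indicator (g n) s :=
    memLp_finsetSum _ fun n _ => ((hg n).memL2Time T).indicator measurableSet_Ioc
  exact h1.add h2

theorem memL2Time_pwConst {E : Type*} [NormedAddCommGroup E] (U : Fin (N + 1) → E) :
    MemL2Time T (G.pwConst U) :=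
  G.memL2Time_glue _ fun _ => continuous_const

theorem memL2Time_pwAffine {E : Type*} [NormedAddCommGroup E] [NormedSpace ℝ E]
    (U : Fin (N + 1) → E) : MemL2Time T (G.pwAffine U) :=
  G.memL2Time_glue _ fun _ => by fun_prop

theorem memL2Time_meanApprox {E : Type*} [NormedAddCommGroup E] [NormedSpace ℝ E] (f : ℝ → E) :
    MemL2Time T (G.meanApprox f) :=
  G.memL2Time_glue _ fun _ => continuous_const

theorem pt_nonneg (n : Fin (N + 1)) : 0 ≤ G.pt n :=
  G.first ▸ G.strictMono.monotone (Fin.zero_le n)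

theorem pt_le (n : Fin (N + 1)) : G.pt n ≤ T :=
  (G.strictMono.monotone (Fin.le_last n)).trans_eq G.last

theorem step_pos (n : Fin N) : 0 < G.step n :=
  sub_pos.2 (G.strictMono n.castSucc_lt_succ)

theorem exists_mem_Ioc {t : ℝ} (ht : t ∈ Ioo 0 T) :
    ∃ n : Fin N, t ∈ Ioc (G.pt n.castSucc) (G.pt n.succ) := by
  have key : ∀ m : Fin (N + 1), t ≤ G.pt m →
      ∃ n : Fin N, t ∈ Ioc (G.pt n.castSucc) (G.pt n.succ) := by
    intro m
    induction m using Fin.induction with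
    | zero => exact fun h => absurd (h.trans_eq G.first) (not_le.2 ht.1)
    | succ n ih =>
      intro h
      by_cases h' : t ≤ G.pt n.castSucc
      · exact ih h'
      · exact ⟨n, not_le.1 h', h⟩
  exact key (Fin.last N) (ht.2.le.trans_eq G.last.symm)

/-- The piecewise constant derivative of `G.pwAffine U`. -/
def pwSlope {E : Type*} [NormedAddCommGroup E] [NormedSpace ℝ E] (U : Fin (N + 1) → E) : ℝ → E :=
  G.glue 0 fun n _ => (G.step n)⁻¹ • (U n.succ - U n.castSucc)

section Slope

variable {E : Type*} [NormedAddCommGroup E] [NormedSpace ℝ E] (U : Fin (N + 1) → E)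

theorem memL2Time_pwSlope : MemL2Time T (G.pwSlope U) :=
  G.memL2Time_glue _ fun _ => continuous_const

variable [CompleteSpace E]

theorem integral_pwSlope_step {n : Fin N} {t : ℝ}
    (ht : t ∈ Icc (G.pt n.castSucc) (G.pt n.succ)) :
    ∫ s in Ioo 0 t, G.pwSlope U s = (∫ s in Ioo 0 (G.pt n.castSucc), G.pwSlope U s) +
      ((t - G.pt n.castSucc) / G.step n) • (U n.succ - U n.castSucc) := by
  have hi : IntegrableOn (G.pwSlope U) (Ioc 0 T) :=
    (integrableOn_Ioc_iff_integrableOn_Ioo).2 (G.memL2Time_pwSlope U).integrableOn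
  rw [← integral_Ioc_eq_integral_Ioo, ← integral_Ioc_eq_integral_Ioo,
    ← Ioc_union_Ioc_eq_Ioc (G.pt_nonneg n.castSucc) ht.1,
    setIntegral_union (Ioc_disjoint_Ioc_of_le le_rfl) measurableSet_Ioc
      (hi.mono_set (Ioc_subset_Ioc_right (G.pt_le _)))
      (hi.mono_set (Ioc_subset_Ioc (G.pt_nonneg _) (ht.2.trans (G.pt_le _)))),
    setIntegral_congr_fun measurableSet_Ioc
      (g := fun _ => (G.step n)⁻¹ • (U n.succ - U n.castSucc))
      fun s hs => G.glue_of_mem _ _ ⟨hs.1, hs.2.trans ht.2⟩, setIntegral_const]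
  congr 1
  rw [Real.volume_real_Ioc_of_le ht.1, smul_smul, div_eq_mul_inv]

theorem integral_pwSlope_pt (m : Fin (N + 1)) :
    ∫ s in Ioo 0 (G.pt m), G.pwSlope U s = U m - U 0 := by
  induction m using Fin.induction with
  | zero => simp [G.first]
  | succ n ih =>
    rw [G.integral_pwSlope_step U ⟨(G.strictMono n.castSucc_lt_succ).le, le_rfl⟩, ih]
    change _ + (G.step n / G.step n) • _ = _
    rw [div_self (G.step_pos n).ne', one_smul]
    abel

theorem pwAffine_eq_primitive {t : ℝ} (ht : t ∈ Ioo 0 T) :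
    G.pwAffine U t = U 0 + ∫ s in Ioo 0 t, G.pwSlope U s := by
  obtain ⟨n, hn⟩ := G.exists_mem_Ioc ht
  rw [G.integral_pwSlope_step U (Ioc_subset_Icc_self hn), G.integral_pwSlope_pt, pwAffine,
    G.glue_of_mem _ _ hn]
  have hs : (G.pt n.succ - t) / G.step n = 1 - (t - G.pt n.castSucc) / G.step n := by
    rw [eq_sub_iff_add_eq, ← add_div, div_eq_one_iff_eq (G.step_pos n).ne']
    rw [step]; ring
  rw [hs, sub_smul, one_smul, smul_sub]
  abel

end Slope

section Euler

variable {V H K : Type*} [NormedAddCommGroup V] [InnerProductSpace ℝ V] [CompleteSpace V]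
  [NormedAddCommGroup H] [InnerProductSpace ℝ H] [NormedAddCommGroup K] [InnerProductSpace ℝ K]
  {j : V →L[ℝ] H} {D : V →L[ℝ] K} {R : StrongDual ℝ V →L[ℝ] V}

/-- The weak formulation of the implicit Euler method after integration by parts in time. -/
theorem integral_testCurve_pwConst (hT : 0 ≤ T)
    (hR : ∀ (Φ : StrongDual ℝ V) (v : V), inner ℝ (D (R Φ)) (D v) = Φ v) {f : ℝ → StrongDual ℝ V}
    {U : Fin (N + 1) → V} (hU : ∀ (n : Fin N) (v : V),
      inner ℝ ((G.step n)⁻¹ • (j (U n.succ) - j (U n.castSucc))) (j v)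
        + inner ℝ (D (U n.succ)) (D v) = G.mean f n v)
    {φ φ' : ℝ → V} (h : IsTestCurve T φ φ') :
    ∫ t in Ioo 0 T, (inner ℝ (D (G.pwConst U t)) (D (φ t)) -
        pullbackForm j (G.pwAffine U t) (φ' t)) =
      (∫ t in Ioo 0 T, G.meanApprox f t (φ t)) + pullbackForm j (U 0) (φ 0) := by
  have hs := G.memL2Time_pwSlope U
  -- On each step the scheme is a pointwise equation: the time derivative falls on the affine
  -- reconstruction, the spatial term on the piecewise constant one.
  refine integral_testCurve_eq hT hR (G.memL2Time_pwAffine U) (G.memL2Time_pwConst U)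
    (hs.clm (pullbackForm j)) (G.memL2Time_meanApprox f) ?_ ?_ h
  · filter_upwards [ae_restrict_mem measurableSet_Ioo] with t ht
    rw [G.pwAffine_eq_primitive U ht, map_add, (pullbackForm j).integral_comp_comm
      (hs.integrableOn.mono_set (Ioo_subset_Ioo_right ht.2.le))]
  · filter_upwards [ae_restrict_mem measurableSet_Ioo] with t ht v
    obtain ⟨n, hn⟩ := G.exists_mem_Ioc ht
    rw [pwSlope, pwConst, meanApprox, G.glue_of_mem _ _ hn, G.glue_of_mem _ _ hn,
      G.glue_of_mem _ _ hn, ← hU n v, pullbackForm_apply, map_smul, map_sub]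

end Euler

end TimeGrid

end ParabolicHeat

end

/-! ### The two error estimates. -/

theorem mainTheorem8 {d : ℕ} (hd : 1 ≤ d) (Ω : Set (ParabolicHeat.Euc d))
    (hΩ : IsOpen Ω) (hΩb : Bornology.IsBounded Ω)
    (T : ℝ) (hT : 0 < T)
    (f : ℝ → ParabolicHeat.Hm1 Ω) (hf : ParabolicHeat.MemL2Time T f)
    (u₀ : ParabolicHeat.H10 Ω)
    (u : ℝ → ParabolicHeat.H10 Ω)
    (hu : ParabolicHeat.IsWeakSolution T f (ParabolicHeat.toL2 u₀) u)
    (N : ℕ) (G : ParabolicHeat.TimeGrid T N)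
    (U : Fin (N + 1) → ParabolicHeat.H10 Ω) (hU : G.IsImplicitEuler f u₀ U) :
    BddAbove (ParabolicHeat.dualQuotientsYT T (f - G.meanApprox f)) ∧
    ParabolicHeat.normX T (u - G.pwConst U) ≤ G.jumpEstimator U + G.oscX f ∧
    ParabolicHeat.normX T (u - G.pwAffine U) ≤ G.jumpEstimator U + G.oscX f := by
  obtain ⟨R, hR⟩ := ParabolicHeat.exists_riesz hd hΩ hΩb
  have hn := ParabolicHeat.dualNorm_eq hd hΩ hΩb hR
  have hfτ := G.memL2Time_meanApprox f
  have hF : ParabolicHeat.MemL2Time T (f - G.meanApprox f) := hf.sub hfτ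
  refine ⟨ParabolicHeat.bddAbove_dualQuotientsYT hR hn hF,
    ParabolicHeat.timeNorm_sub_le_of_residual_le (j := ParabolicHeat.toL2) hT.le hR hu.1.1
      (G.memL2Time_pwConst U) (G.memL2Time_pwAffine U)
      (ParabolicHeat.sSup_dualQuotientsYT_nonneg hT (f - G.meanApprox f)) fun φ φ' h => ?_⟩
  have hφ := h.continuous.memL2Time T
  have h1 := (h.memYT hT.le).integral_dual_le_sSup hT hR hn hF
  rw [h.normYT_eq hT hR hn] at h1
  -- The initial terms coincide because `U 0 = u₀`, so the residual is exactly `∫ ⟨f - f_τ, φ⟩`.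
  rw [hu.integral_testCurve hT hR hf h,
    G.integral_testCurve_pwConst hT.le hR hU.2 h, hU.1, add_sub_add_right_eq_sub,
    ← integral_sub (ParabolicHeat.integrableOn_dual hR hf hφ)
      (ParabolicHeat.integrableOn_dual hR hfτ hφ)]
  exact h1
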